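/- Let $a>b>0$, $p^2=a^2+b^2$, $r^2=a^2-b^2$. On $\mathbb R^9$ with coordinates $(\omega,\alpha,\beta)\in(\mathbb R^3)^3$ consider $$H=\omega_1^2+\omega_2^2+\tfrac12\omega_3^2-\alpha_1-\beta_2,\qquad K=(\omega_1^2-\omega_2^2+\alpha_1-\beta_2)^2+(2\omega_1\omega_2+\alpha_2+\beta_1)^2,$$ $$\begin{aligned}G={}&(\omega_1\alpha_1+\omega_2\alpha_2+\tfrac12\omega_3\alpha_3)^2+(\omega_1\beta_1+\omega_2\beta_2+\tfrac12\omega_3\beta_3)^2\\&+\omega_3\bigl[\omega_1(\alpha_2\beta_3-\alpha_3\beta_2)+\omega_2(\alpha_3\beta_1-\alpha_1\beta_3)+\tfrac12\omega_3(\alpha_1\beta_2-\alpha_2\beta_1)\bigr]\\&-\alpha_1\,\beta^2-\beta_2\,\alpha^2+(\alpha_2+\beta_1)(\alpha\cdot\beta),\end{aligned}$$ $$F=(2G-p^2H)^2-r^4K,\qquad M=\frac{1}{r^4}(2G-p^2H).$$ Let $\mathcal P=\{\alpha^2=a^2,\ \beta^2=b^2,\ \alpha\cdot\beta=0\}$,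 let $\mathcal N$ be the set of all $x\in\mathcal P$ with $F(x)=0$ at which the differential of $F|_{\mathcal P}$ vanishes, and for $(m,h)\in\mathbb R^2$ let $$J_{m,h}=\{x\in\mathcal N:\ M(x)=m,\ H(x)=h\}\subset\mathbb R^9.$$ In the $(m,h)$-plane let $$L_0=\{2p^2m^2+2hm+1=0,\ m<0\},\qquad q_1=\Bigl(-\frac1{2b},\frac{a^2+3b^2}{2b}\Bigr),\qquad q_2=\Bigl(-\frac1{2a},\frac{3a^2+b^2}{2a}\Bigr),$$ and let segments $11$, $12$, $13$ be the parts of $L_0$ on which $m<-\frac1{2b}$, $-\frac1{2b}<m<-\frac1{2a}$, $-\frac1{2a}<m<0$, respectively. Put $h_*=-\frac12(h+p^2m)$ and $$\Gamma_1=\{(u_1,Q_1,P_1)\in\mathbb R^3:\ Q_1^2+u_1^2=1,\ P_1^2=h_*u_1^2-a^2m\},$$ $$\Gamma_2=\{(u_2,Q_2,P_2)\in\mathbb R^3:\ Q_2^2+u_2^2=1,\ P_2^2=b^2m\,u_2^2-h_*\},$$ and let $\mathbb Z_2$ act on $\Gamma_1\times\Gamma_2$ by the diagonal involution $\chi=(\chi_1,\chi_2)$,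 $$\chi_1(u_1,Q_1,P_1)=(-u_1,Q_1,-P_1),\qquad \chi_2(u_2,Q_2,P_2)=(-u_2,-Q_2,P_2).$$ Let $\mathbb T^2=S^1\times S^1$, let $\mathcal V$ be the eight-curve (two circles with one common point, at which they cross transversally), let $\mathcal W$ be the union of two circles crossing transversally at two points, and let $nS$ denote the disjoint union of $n$ copies of $S$. Then $L_0$ is the union of segments $11$, $12$, $13$ and the points $q_1,q_2$; for every $(m,h)\in L_0$ the integral manifold $J_{m,h}$ is homeomorphic to $(\Gamma_1\times\Gamma_2)/\chi$; and, up to homeomorphism, 1. $J_{m,h}\cong 2\mathbb T^2$ if $(m,h)$ lies on segment $11$ or on segment $12$; 2. $J_{m,h}\cong 4\mathbb T^2$ if $(m,h)$ lies on segment $13$; 3. $J_{m,h}\cong\mathcal W\times S^1$ if $(m,h)=q_1$; 4. $J_{m,h}\cong 2\,\mathcal V\times S^1$ if $(m,h)=q_2$. -/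

import Mathlib

namespace DoubleField

noncomputable section

/-- The ambient space `ℝ⁹` of triples `(ω, α, β)`: the angular velocity and the two force vectors,
in the frame attached to the body. The indices `0, 1, 2` are the coordinates `1, 2, 3`. -/
abbrev Ambient : Type := (Fin 3 → ℝ) × (Fin 3 → ℝ) × (Fin 3 → ℝ)

/-- The Casimir functions `(α², β², α·β)`. -/
def casimir (x : Ambient) : ℝ × ℝ × ℝ :=
  (x.2.1 ⬝ᵥ x.2.1, x.2.2 ⬝ᵥ x.2.2, x.2.1 ⬝ᵥ x.2.2)

/-- The phase space `𝒫 = {α² = a², β² = b², α·β = 0}`. -/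
def phaseSpace (a b : ℝ) : Set Ambient :=
  {x | casimir x = (a ^ 2, b ^ 2, 0)}

/-- The Hamilton function. -/
def H : Ambient → ℝ := fun (ω, α, β) =>
  ω 0 ^ 2 + ω 1 ^ 2 + ω 2 ^ 2 / 2 - α 0 - β 1

/-- The first integral `K`. -/
def K : Ambient → ℝ := fun (ω, α, β) =>
  (ω 0 ^ 2 - ω 1 ^ 2 + α 0 - β 1) ^ 2 + (2 * ω 0 * ω 1 + α 1 + β 0) ^ 2

/-- The first integral `G`. -/
def G : Ambient → ℝ := fun (ω, α, β) =>
  (ω 0 * α 0 + ω 1 * α 1 + ω 2 * α 2 / 2) ^ 2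
    + (ω 0 * β 0 + ω 1 * β 1 + ω 2 * β 2 / 2) ^ 2
    + ω 2 * (ω 0 * (α 1 * β 2 - α 2 * β 1) + ω 1 * (α 2 * β 0 - α 0 * β 2)
        + ω 2 * (α 0 * β 1 - α 1 * β 0) / 2)
    - α 0 * (β ⬝ᵥ β) - β 1 * (α ⬝ᵥ α) + (α 1 + β 0) * (α ⬝ᵥ β)

/-- `F = (2G - p²H)² - r⁴K`, where `p² = a² + b²` and `r² = a² - b²`. -/
def F (a b : ℝ) (x : Ambient) : ℝ :=
  (2 * G x - (a ^ 2 + b ^ 2) * H x) ^ 2 - (a ^ 2 - b ^ 2) ^ 2 * K x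

/-- `M = (2G - p²H) / r⁴`. -/
def M (a b : ℝ) (x : Ambient) : ℝ :=
  (2 * G x - (a ^ 2 + b ^ 2) * H x) / (a ^ 2 - b ^ 2) ^ 2

/-- The critical subsystem `𝒩 = {x ∈ 𝒫 : F(x) = 0, dF(x) = 0}`. Here `dF(x)` is the differential
of `F` restricted to `𝒫`, a linear form on the tangent space `T_x𝒫 = ker d(casimir)(x)`. -/
def criticalSet (a b : ℝ) : Set Ambient :=
  {x | x ∈ phaseSpace a b ∧ F a b x = 0 ∧
    ∀ v : Ambient, fderiv ℝ casimir x v = 0 → fderiv ℝ (F a b) x v = 0}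

/-- The integral manifold `J_{m,h} = {x ∈ 𝒩 : M(x) = m, H(x) = h}`, with the topology induced
from `ℝ⁹`. -/
def integralManifold (a b m h : ℝ) : Set Ambient :=
  {x | x ∈ criticalSet a b ∧ M a b x = m ∧ H x = h}

/-- The curve `L₀` in the `(m,h)`-plane. -/
def L0 (a b : ℝ) : Set (ℝ × ℝ) :=
  {c | 2 * (a ^ 2 + b ^ 2) * c.1 ^ 2 + 2 * c.2 * c.1 + 1 = 0 ∧ c.1 < 0}

/-- The point of `L₀` at which it touches the line `h = -r²m + 2b`. -/
def q1 (a b : ℝ) : ℝ × ℝ := (-1 / (2 * b), (a ^ 2 + 3 * b ^ 2) / (2 * b))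

/-- The point of `L₀` at which it touches the line `h = r²m + 2a`. -/
def q2 (a b : ℝ) : ℝ × ℝ := (-1 / (2 * a), (3 * a ^ 2 + b ^ 2) / (2 * a))

/-- The arc of `L₀` on which `m < m(q₁)`. -/
def segment11 (a b : ℝ) : Set (ℝ × ℝ) := {c | c ∈ L0 a b ∧ c.1 < (q1 a b).1}

/-- The arc of `L₀` between `q₁` and `q₂`. -/
def segment12 (a b : ℝ) : Set (ℝ × ℝ) :=
  {c | c ∈ L0 a b ∧ (q1 a b).1 < c.1 ∧ c.1 < (q2 a b).1}

/-- The arc of `L₀` on which `m(q₂) < m < 0`. -/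
def segment13 (a b : ℝ) : Set (ℝ × ℝ) := {c | c ∈ L0 a b ∧ (q2 a b).1 < c.1}

/-- The constant `h_* = -(h + p²m)/2`. -/
def hStar (a b m h : ℝ) : ℝ := -(h + (a ^ 2 + b ^ 2) * m) / 2

/-- The curve `Γ₁ ⊂ ℝ³(u₁, Q₁, P₁)`. -/
def Gamma1 (a b l m h : ℝ) : Set (ℝ × ℝ × ℝ) :=
  {(u, Q, P) | Q ^ 2 + u ^ 2 = 1 ∧ P ^ 2 = hStar a b m h * u ^ 2 + a * l * u - a ^ 2 * m}

/-- The curve `Γ₂ ⊂ ℝ³(u₂, Q₂, P₂)`. -/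
def Gamma2 (a b l m h : ℝ) : Set (ℝ × ℝ × ℝ) :=
  {(u, Q, P) | Q ^ 2 + u ^ 2 = 1 ∧ P ^ 2 = b ^ 2 * m * u ^ 2 - b * l * u - hStar a b m h}

/-- The involution `χ₁` of `ℝ³(u₁, Q₁, P₁)`. -/
def chi1 : ℝ × ℝ × ℝ → ℝ × ℝ × ℝ := fun (u, Q, P) => (-u, Q, -P)

/-- The involution `χ₂` of `ℝ³(u₂, Q₂, P₂)`. -/
def chi2 : ℝ × ℝ × ℝ → ℝ × ℝ × ℝ := fun (u, Q, P) => (-u, -Q, P)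

/-- The diagonal involution `χ = (χ₁, χ₂)`. -/
def chi : (ℝ × ℝ × ℝ) × (ℝ × ℝ × ℝ) → (ℝ × ℝ × ℝ) × (ℝ × ℝ × ℝ) := Prod.map chi1 chi2

theorem chi_chi (x : (ℝ × ℝ × ℝ) × (ℝ × ℝ × ℝ)) : chi (chi x) = x := by
  obtain ⟨⟨u, Q, P⟩, ⟨u', Q', P'⟩⟩ := x
  simp [chi, chi1, chi2]

/-- For `ℓ = 0` the product `Γ₁ × Γ₂` is invariant under `χ`. -/
theorem chi_mem (a b m h : ℝ) {x : (ℝ × ℝ × ℝ) × (ℝ × ℝ × ℝ)}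
    (hx : x ∈ Gamma1 a b 0 m h ×ˢ Gamma2 a b 0 m h) :
    chi x ∈ Gamma1 a b 0 m h ×ˢ Gamma2 a b 0 m h := by
  obtain ⟨⟨u, Q, P⟩, ⟨u', Q', P'⟩⟩ := x
  simpa [chi, chi1, chi2, Gamma1, Gamma2] using hx

/-- The equivalence relation on `Γ₁ × Γ₂` (for `ℓ = 0`) whose classes are the orbits of the
`ℤ₂`-action generated by `χ`. -/
def chiOrbit (a b m h : ℝ) : Setoid ↥(Gamma1 a b 0 m h ×ˢ Gamma2 a b 0 m h) where
  r x y := x.1 = y.1 ∨ x.1 = chi y.1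
  iseqv :=
    { refl := fun _ => Or.inl rfl
      symm := by
        rintro x y (e | e)
        · exact Or.inl e.symm
        · exact Or.inr (by rw [e, chi_chi])
      trans := by
        rintro x y z (e | e) (f | f)
        · exact Or.inl (e.trans f)
        · exact Or.inr (e.trans f)
        · exact Or.inr (by rw [e, f])
        · exact Or.inl (by rw [e, f, chi_chi]) }

/-- The quotient space `(Γ₁ × Γ₂) / χ` for `ℓ = 0`, with the quotient topology. -/
abbrev GammaQuotient (a b m h : ℝ) : Type := Quotient (chiOrbit a b m h)

/-- The torus `𝕋²`. -/
abbrev Torus : Type := Circle × Circle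

/-- The eight-curve `𝒱`: two circles with one common point, realized as the plane lemniscate
`y² = x²(1 - x²)`, whose only self-intersection, at the origin, is transversal. -/
def eightCurve : Set (ℝ × ℝ) := {(x, y) | y ^ 2 = x ^ 2 * (1 - x ^ 2)}

/-- The curve `𝒲`: the union of the two plane circles of radius `√2` centred at `(±1, 0)`, which
intersect transversally at the two points `(0, ±1)`. -/
def doubleCircle : Set (ℝ × ℝ) := {(x, y) | (x - 1) ^ 2 + y ^ 2 = 2 ∨ (x + 1) ^ 2 + y ^ 2 = 2}

end

end DoubleField

namespace DoubleField

noncomputable section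

/-! Put w = ω₁ + iω₂, X = (α₁ − β₂) + i(α₂ + β₁), Y = (α₁ + β₂) + i(α₂ − β₁), z = α₃ + iβ₃. Then 𝒫
becomes z² + XȲ = r², |X|² + |Y|² + 2|z|² = 2p², and K = |w² + X|². Where X ≠ 0, the conditions F =
0, dF = 0, M = m < 0 amount to |X|²ω₃ = 2 Re(z w X̄) and (w² + X)X̄ = r²mX. They imply (|w|² +
m(|X|² + |z|²))² = |X|²(2mH + 1 + 2p²m²), whose right side vanishes on L₀; there the energy equation
reduces to |w|² = −m(|X|² + |z|²) (`RegularEqs.H_relation`, `mem_integralManifold_regular`). The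
locus X = 0 has its own equations (`mem_integralManifold_singular`).

The map `param` solves all these equations rationally over Γ₁ × Γ₂. Its image is the whole integral
manifold, and its fibres are the χ-orbits: the phase point determines Q₁, P₂ and the tensor product
(u₁, P₁) ⊗ (u₂, Q₂), hence both vectors up to a common sign. A continuous surjection from a compact
space to a Hausdorff space, with the orbits as fibres, gives the homeomorphism with (Γ₁ × Γ₂)/χ.

On L₀ one has 4m h_* = 1, so each Γᵢ is the intersection of a circular and an elliptic cylinder: two
circles, except at |m| = 1/(2a) for Γ₁ and at |m| = 1/(2b) for Γ₂, where the circles cross. If 4a²m²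
> 1, χ exchanges the sheets P₁ > 0 and P₁ < 0, and the quotient is S¹ × Γ₂. If 4a²m² < 1, χ acts on
each of four tori by (c, d) ↦ (−c, −d), whose quotient is again a torus. If 4a²m² = 1, the invariant
product cd trivializes a circle bundle over Γ₁/χ₁, which is an eight-curve; the sign of P₂ gives two
copies. -/

/-- The combination `2G - p²H`. -/
def combo (a b : ℝ) (x : Ambient) : ℝ := 2 * G x - (a ^ 2 + b ^ 2) * H x

/-! ### Differentials of the integrals and of the Casimir functions -/

/-- The derivative of `G` along `v`. -/
def dG : Ambient → Ambient → ℝ := fun (ω, α, β) (dω, dα, dβ) =>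
  2 * (ω 0 * α 0 + ω 1 * α 1 + ω 2 * α 2 / 2) *
      (dω 0 * α 0 + ω 0 * dα 0 + dω 1 * α 1 + ω 1 * dα 1 + (dω 2 * α 2 + ω 2 * dα 2) / 2)
    + 2 * (ω 0 * β 0 + ω 1 * β 1 + ω 2 * β 2 / 2) *
      (dω 0 * β 0 + ω 0 * dβ 0 + dω 1 * β 1 + ω 1 * dβ 1 + (dω 2 * β 2 + ω 2 * dβ 2) / 2)
    + dω 2 * (ω 0 * (α 1 * β 2 - α 2 * β 1) + ω 1 * (α 2 * β 0 - α 0 * β 2)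
        + ω 2 * (α 0 * β 1 - α 1 * β 0) / 2)
    + ω 2 * (dω 0 * (α 1 * β 2 - α 2 * β 1)
        + ω 0 * (dα 1 * β 2 + α 1 * dβ 2 - dα 2 * β 1 - α 2 * dβ 1)
        + dω 1 * (α 2 * β 0 - α 0 * β 2)
        + ω 1 * (dα 2 * β 0 + α 2 * dβ 0 - dα 0 * β 2 - α 0 * dβ 2)
        + dω 2 * (α 0 * β 1 - α 1 * β 0) / 2
        + ω 2 * (dα 0 * β 1 + α 0 * dβ 1 - dα 1 * β 0 - α 1 * dβ 0) / 2)
    - dα 0 * (β ⬝ᵥ β) - α 0 * (2 * (β ⬝ᵥ dβ)) - dβ 1 * (α ⬝ᵥ α) - β 1 * (2 * (α ⬝ᵥ dα))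
    + (dα 1 + dβ 0) * (α ⬝ᵥ β) + (α 1 + β 0) * (dα ⬝ᵥ β + α ⬝ᵥ dβ)

/-- The derivative of `H` along `v`. -/
def dH : Ambient → Ambient → ℝ := fun (ω, _, _) (dω, dα, dβ) =>
  2 * ω 0 * dω 0 + 2 * ω 1 * dω 1 + ω 2 * dω 2 - dα 0 - dβ 1

/-- The derivative of `K` along `v`. -/
def dK : Ambient → Ambient → ℝ := fun (ω, α, β) (dω, dα, dβ) =>
  2 * (ω 0 ^ 2 - ω 1 ^ 2 + α 0 - β 1) * (2 * ω 0 * dω 0 - 2 * ω 1 * dω 1 + dα 0 - dβ 1)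
    + 2 * (2 * ω 0 * ω 1 + α 1 + β 0)
      * (2 * dω 0 * ω 1 + 2 * ω 0 * dω 1 + dα 1 + dβ 0)

theorem hasDerivAt_line (c d : ℝ) : HasDerivAt (fun t : ℝ => c + t * d) d 0 := by
  simpa using ((hasDerivAt_id (0 : ℝ)).mul_const d).const_add c

theorem hasDerivAt_H (x v : Ambient) : HasDerivAt (fun t : ℝ => H (x + t • v)) (dH x v) 0 := by
  obtain ⟨ω, α, β⟩ := x
  obtain ⟨dω, dα, dβ⟩ := v
  have o := fun i => hasDerivAt_line (ω i) (dω i)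
  have p := fun i => hasDerivAt_line (α i) (dα i)
  have q := fun i => hasDerivAt_line (β i) (dβ i)
  have := (((((o 0).pow 2).add ((o 1).pow 2)).add (((o 2).pow 2).div_const 2)).sub (p 0)).sub (q 1)
  refine this.congr_deriv ?_
  simp [dH]
  ring

theorem hasDerivAt_K (x v : Ambient) : HasDerivAt (fun t : ℝ => K (x + t • v)) (dK x v) 0 := by
  obtain ⟨ω, α, β⟩ := x
  obtain ⟨dω, dα, dβ⟩ := v
  have o := fun i => hasDerivAt_line (ω i) (dω i)
  have p := fun i => hasDerivAt_line (α i) (dα i)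
  have q := fun i => hasDerivAt_line (β i) (dβ i)
  have := ((((((o 0).pow 2).sub ((o 1).pow 2)).add (p 0)).sub (q 1)).pow 2).add
    ((((((o 0).const_mul 2).mul (o 1)).add (p 1)).add (q 0)).pow 2)
  refine this.congr_deriv ?_
  simp [dK]

theorem hasDerivAt_dotProduct (α dα β dβ : Fin 3 → ℝ) :
    HasDerivAt (fun t : ℝ => (α + t • dα) ⬝ᵥ (β + t • dβ)) (dα ⬝ᵥ β + α ⬝ᵥ dβ) 0 := by
  have p := fun i => hasDerivAt_line (α i) (dα i)
  have q := fun i => hasDerivAt_line (β i) (dβ i)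
  have := (((p 0).mul (q 0)).add ((p 1).mul (q 1))).add ((p 2).mul (q 2))
  refine (this.congr_deriv ?_).congr_of_eventuallyEq (.of_forall fun t => ?_)
  · simp [dotProduct, Fin.sum_univ_three]
    ring
  · simp [dotProduct, Fin.sum_univ_three]

theorem hasDerivAt_G (x v : Ambient) : HasDerivAt (fun t : ℝ => G (x + t • v)) (dG x v) 0 := by
  obtain ⟨ω, α, β⟩ := x
  obtain ⟨dω, dα, dβ⟩ := v
  have o := fun i => hasDerivAt_line (ω i) (dω i)
  have p := fun i => hasDerivAt_line (α i) (dα i)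
  have q := fun i => hasDerivAt_line (β i) (dβ i)
  have s := (((((o 0).mul (p 0)).add ((o 1).mul (p 1))).add
    (((o 2).mul (p 2)).div_const 2)).pow 2).add
    (((((o 0).mul (q 0)).add ((o 1).mul (q 1))).add (((o 2).mul (q 2)).div_const 2)).pow 2)
  have t := (o 2).mul (((((o 0).mul (((p 1).mul (q 2)).sub ((p 2).mul (q 1))))).add
    ((o 1).mul (((p 2).mul (q 0)).sub ((p 0).mul (q 2))))).add
    (((o 2).mul (((p 0).mul (q 1)).sub ((p 1).mul (q 0)))).div_const 2))
  have := (((s.add t).sub ((p 0).mul (hasDerivAt_dotProduct β dβ β dβ))).sub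
    ((q 1).mul (hasDerivAt_dotProduct α dα α dα))).add
    (((p 1).add (q 0)).mul (hasDerivAt_dotProduct α dα β dβ))
  refine this.congr_deriv ?_
  simp [dG, dotProduct_comm dα α, dotProduct_comm dβ β]
  ring

theorem differentiable_F (a b : ℝ) : Differentiable ℝ (F a b) := by
  unfold F G H K dotProduct
  simp only [Fin.sum_univ_three]
  fun_prop

theorem differentiable_casimir : Differentiable ℝ casimir := by
  unfold casimir dotProduct
  simp only [Fin.sum_univ_three]
  fun_prop

theorem fderiv_F (a b : ℝ) (x v : Ambient) :
    fderiv ℝ (F a b) x v = 2 * combo a b x * (2 * dG x v - (a ^ 2 + b ^ 2) * dH x v)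
      - (a ^ 2 - b ^ 2) ^ 2 * dK x v := by
  rw [← (differentiable_F a b x).lineDeriv_eq_fderiv]
  have h := (((((hasDerivAt_G x v).const_mul 2).sub
    ((hasDerivAt_H x v).const_mul (a ^ 2 + b ^ 2))).pow 2).sub
    ((hasDerivAt_K x v).const_mul ((a ^ 2 - b ^ 2) ^ 2)))
  refine (HasLineDerivAt.lineDeriv (h.congr_deriv ?_))
  simp [combo]

theorem fderiv_casimir (x v : Ambient) :
    fderiv ℝ casimir x v = (2 * (x.2.1 ⬝ᵥ v.2.1), 2 * (x.2.2 ⬝ᵥ v.2.2),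
      v.2.1 ⬝ᵥ x.2.2 + x.2.1 ⬝ᵥ v.2.2) := by
  rw [← (differentiable_casimir x).lineDeriv_eq_fderiv]
  have h := (hasDerivAt_dotProduct x.2.1 v.2.1 x.2.1 v.2.1).prodMk
    ((hasDerivAt_dotProduct x.2.2 v.2.2 x.2.2 v.2.2).prodMk
      (hasDerivAt_dotProduct x.2.1 v.2.1 x.2.2 v.2.2))
  refine (HasLineDerivAt.lineDeriv (h.congr_deriv ?_))
  rw [dotProduct_comm v.2.1 x.2.1, dotProduct_comm v.2.2 x.2.2, two_mul, two_mul]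

/-! ### Complex coordinates w, X, Y, z on the phase space -/

/-- The point of `ℝ⁹` with `ω = (o₁, o₂, o₃)`, `α₁ - β₂ = X₁`, `α₂ + β₁ = X₂`, `α₁ + β₂ = Y₁`,
`α₂ - β₁ = Y₂`, `α₃ = z₁`, `β₃ = z₂`. -/
def point (o₁ o₂ o₃ X₁ X₂ Y₁ Y₂ z₁ z₂ : ℝ) : Ambient :=
  (![o₁, o₂, o₃], ![(X₁ + Y₁) / 2, (X₂ + Y₂) / 2, z₁], ![(X₂ - Y₂) / 2, (Y₁ - X₁) / 2, z₂])

theorem exists_point (x : Ambient) :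
    ∃ o₁ o₂ o₃ X₁ X₂ Y₁ Y₂ z₁ z₂, x = point o₁ o₂ o₃ X₁ X₂ Y₁ Y₂ z₁ z₂ := by
  obtain ⟨ω, α, β⟩ := x
  refine ⟨ω 0, ω 1, ω 2, α 0 - β 1, α 1 + β 0, α 0 + β 1, α 1 - β 0, α 2, β 2, ?_⟩
  unfold point
  refine Prod.ext ?_ (Prod.ext ?_ ?_) <;> ext i <;> fin_cases i <;> simp

section

variable {a b o₁ o₂ o₃ X₁ X₂ Y₁ Y₂ z₁ z₂ d₁ d₂ d₃ dX₁ dX₂ dY₁ dY₂ dz₁ dz₂ : ℝ}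

/-- The first two equations are the real and imaginary parts of z² + XȲ = r²: they combine α² − β²
with 2α·β. The third is 2(α² + β²). -/
theorem point_mem_phaseSpace :
    point o₁ o₂ o₃ X₁ X₂ Y₁ Y₂ z₁ z₂ ∈ phaseSpace a b ↔
      z₁ ^ 2 - z₂ ^ 2 + X₁ * Y₁ + X₂ * Y₂ = a ^ 2 - b ^ 2 ∧
      2 * z₁ * z₂ + X₂ * Y₁ - X₁ * Y₂ = 0 ∧
      X₁ ^ 2 + X₂ ^ 2 + Y₁ ^ 2 + Y₂ ^ 2 + 2 * z₁ ^ 2 + 2 * z₂ ^ 2 = 2 * (a ^ 2 + b ^ 2) := by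
  simp only [phaseSpace, casimir, point, Set.mem_ofPred_eq, Prod.mk.injEq, dotProduct,
    Fin.sum_univ_three, Matrix.cons_val]
  constructor
  · rintro ⟨h₁, h₂, h₃⟩
    exact ⟨by linear_combination h₁ - h₂, by linear_combination 2 * h₃,
      by linear_combination 2 * h₁ + 2 * h₂⟩
  · rintro ⟨h₁, h₂, h₃⟩
    exact ⟨by linear_combination h₁ / 2 + h₃ / 4, by linear_combination h₃ / 4 - h₁ / 2,
      by linear_combination h₂ / 2⟩

theorem fderiv_casimir_point :
    fderiv ℝ casimir (point o₁ o₂ o₃ X₁ X₂ Y₁ Y₂ z₁ z₂)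
        (point d₁ d₂ d₃ dX₁ dX₂ dY₁ dY₂ dz₁ dz₂) = 0 ↔
      2 * z₁ * dz₁ - 2 * z₂ * dz₂ + dX₁ * Y₁ + X₁ * dY₁ + dX₂ * Y₂ + X₂ * dY₂ = 0 ∧
      2 * dz₁ * z₂ + 2 * z₁ * dz₂ + dX₂ * Y₁ + X₂ * dY₁ - dX₁ * Y₂ - X₁ * dY₂ = 0 ∧
      X₁ * dX₁ + X₂ * dX₂ + Y₁ * dY₁ + Y₂ * dY₂ + 2 * z₁ * dz₁ + 2 * z₂ * dz₂ = 0 := by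
  rw [fderiv_casimir]
  simp only [point, Prod.mk_eq_zero, dotProduct, Fin.sum_univ_three, Matrix.cons_val]
  constructor
  · rintro ⟨h₁, h₂, h₃⟩
    exact ⟨by linear_combination h₁ - h₂, by linear_combination 2 * h₃,
      by linear_combination h₁ + h₂⟩
  · rintro ⟨h₁, h₂, h₃⟩
    exact ⟨by linear_combination h₁ / 2 + h₃ / 2, by linear_combination h₃ / 2 - h₁ / 2,
      by linear_combination h₂ / 2⟩

theorem H_point : H (point o₁ o₂ o₃ X₁ X₂ Y₁ Y₂ z₁ z₂) = o₁ ^ 2 + o₂ ^ 2 + o₃ ^ 2 / 2 - Y₁ := by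
  simp [H, point]
  ring

theorem K_point : K (point o₁ o₂ o₃ X₁ X₂ Y₁ Y₂ z₁ z₂) =
    (o₁ ^ 2 - o₂ ^ 2 + X₁) ^ 2 + (2 * o₁ * o₂ + X₂) ^ 2 := by
  simp [K, point]
  ring

theorem dK_point : dK (point o₁ o₂ o₃ X₁ X₂ Y₁ Y₂ z₁ z₂)
      (point d₁ d₂ d₃ dX₁ dX₂ dY₁ dY₂ dz₁ dz₂) =
    2 * (o₁ ^ 2 - o₂ ^ 2 + X₁) * (2 * o₁ * d₁ - 2 * o₂ * d₂ + dX₁)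
      + 2 * (2 * o₁ * o₂ + X₂) * (2 * d₁ * o₂ + 2 * o₁ * d₂ + dX₂) := by
  simp [dK, point]
  ring

theorem combo_point (hx : point o₁ o₂ o₃ X₁ X₂ Y₁ Y₂ z₁ z₂ ∈ phaseSpace a b) :
    2 * combo a b (point o₁ o₂ o₃ X₁ X₂ Y₁ Y₂ z₁ z₂) =
      -(X₁ ^ 2 + X₂ ^ 2) * o₃ ^ 2
        + 4 * o₃ * (z₁ * (o₁ * X₁ + o₂ * X₂) - z₂ * (o₂ * X₁ - o₁ * X₂))
        - 2 * (z₁ ^ 2 + z₂ ^ 2) * (o₁ ^ 2 + o₂ ^ 2)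
        + 2 * ((o₁ ^ 2 - o₂ ^ 2) * (X₁ * Y₁ - X₂ * Y₂) + 2 * o₁ * o₂ * (X₁ * Y₂ + X₂ * Y₁))
        + 2 * X₁ * (a ^ 2 - b ^ 2) := by
  obtain ⟨h₁, h₂, h₃⟩ := point_mem_phaseSpace.1 hx
  simp only [combo, H_point]
  simp only [G, point, dotProduct, Fin.sum_univ_three, Matrix.cons_val]
  linear_combination (o₃ ^ 2 + 2 * (o₁ ^ 2 + o₂ ^ 2) - 2 * Y₁) / 2 * h₃ + 2 * X₁ * h₁ + 2 * X₂ * h₂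

theorem dcombo_point (hx : point o₁ o₂ o₃ X₁ X₂ Y₁ Y₂ z₁ z₂ ∈ phaseSpace a b)
    (hv : fderiv ℝ casimir (point o₁ o₂ o₃ X₁ X₂ Y₁ Y₂ z₁ z₂)
        (point d₁ d₂ d₃ dX₁ dX₂ dY₁ dY₂ dz₁ dz₂) = 0) :
    2 * dG (point o₁ o₂ o₃ X₁ X₂ Y₁ Y₂ z₁ z₂) (point d₁ d₂ d₃ dX₁ dX₂ dY₁ dY₂ dz₁ dz₂)
      - (a ^ 2 + b ^ 2) * dH (point o₁ o₂ o₃ X₁ X₂ Y₁ Y₂ z₁ z₂)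
        (point d₁ d₂ d₃ dX₁ dX₂ dY₁ dY₂ dz₁ dz₂) =
      -(X₁ * dX₁ + X₂ * dX₂) * o₃ ^ 2 - (X₁ ^ 2 + X₂ ^ 2) * o₃ * d₃
        + 2 * d₃ * (z₁ * (o₁ * X₁ + o₂ * X₂) - z₂ * (o₂ * X₁ - o₁ * X₂))
        + 2 * o₃ * (dz₁ * (o₁ * X₁ + o₂ * X₂)
          + z₁ * (d₁ * X₁ + o₁ * dX₁ + d₂ * X₂ + o₂ * dX₂)
          - dz₂ * (o₂ * X₁ - o₁ * X₂)
          - z₂ * (d₂ * X₁ + o₂ * dX₁ - d₁ * X₂ - o₁ * dX₂))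
        - 2 * (z₁ * dz₁ + z₂ * dz₂) * (o₁ ^ 2 + o₂ ^ 2)
        - 2 * (z₁ ^ 2 + z₂ ^ 2) * (o₁ * d₁ + o₂ * d₂)
        + 2 * (o₁ * d₁ - o₂ * d₂) * (X₁ * Y₁ - X₂ * Y₂)
        + (o₁ ^ 2 - o₂ ^ 2) * (dX₁ * Y₁ + X₁ * dY₁ - dX₂ * Y₂ - X₂ * dY₂)
        + 2 * (d₁ * o₂ + o₁ * d₂) * (X₁ * Y₂ + X₂ * Y₁)
        + 2 * o₁ * o₂ * (dX₁ * Y₂ + X₁ * dY₂ + dX₂ * Y₁ + X₂ * dY₁)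
        + dX₁ * (a ^ 2 - b ^ 2) := by
  obtain ⟨h₁, h₂, h₃⟩ := point_mem_phaseSpace.1 hx
  obtain ⟨t₁, t₂, t₃⟩ := fderiv_casimir_point.1 hv
  simp only [dG, dH, point, dotProduct, Fin.sum_univ_three, Matrix.cons_val]
  linear_combination (o₃ * d₃ + 2 * (o₁ * d₁ + o₂ * d₂) - dY₁) / 2 * h₃
    + (o₃ ^ 2 + 2 * (o₁ ^ 2 + o₂ ^ 2) - 2 * Y₁) / 2 * t₃ + dX₁ * h₁ + X₁ * t₁ + dX₂ * h₂ + X₂ * t₂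

end

/-! ### Equations of the integral manifold over L₀ -/

theorem four_mul_hStar {a b m h : ℝ} (hL : (m, h) ∈ L0 a b) : 4 * m * hStar a b m h = 1 := by
  obtain ⟨h₁, -⟩ := hL
  simp only at h₁
  unfold hStar
  linear_combination -h₁

theorem mem_integralManifold_iff {a b m h : ℝ} (hab : a ^ 2 - b ^ 2 ≠ 0) {x : Ambient} :
    x ∈ integralManifold a b m h ↔
      x ∈ phaseSpace a b ∧ combo a b x ^ 2 = (a ^ 2 - b ^ 2) ^ 2 * K x ∧
      (∀ v : Ambient, fderiv ℝ casimir x v = 0 → fderiv ℝ (F a b) x v = 0) ∧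
      combo a b x = (a ^ 2 - b ^ 2) ^ 2 * m ∧ H x = h := by
  have hM : M a b x = m ↔ combo a b x = (a ^ 2 - b ^ 2) ^ 2 * m := by
    unfold M
    rw [div_eq_iff (pow_ne_zero 2 hab), mul_comm m]
    rfl
  have hF : F a b x = 0 ↔ combo a b x ^ 2 = (a ^ 2 - b ^ 2) ^ 2 * K x := sub_eq_zero
  unfold integralManifold criticalSet
  rw [Set.mem_ofPred_eq, Set.mem_ofPred_eq, hM, hF, and_assoc, and_assoc]

section

variable {a b m h o₁ o₂ o₃ X₁ X₂ Y₁ Y₂ z₁ z₂ d₁ d₂ d₃ dX₁ dX₂ dY₁ dY₂ dz₁ dz₂ : ℝ}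

/-- Completing the square in ω₃ after multiplication by |X|². With g = w X̄, the square is that of
|X|²ω₃ − 2 Re(zg), and the remainder is 2r² Re(g² + |X|²X̄); Y drops out through XȲ = r² − z². -/
theorem normSq_mul_combo_point (hx : point o₁ o₂ o₃ X₁ X₂ Y₁ Y₂ z₁ z₂ ∈ phaseSpace a b) :
    2 * (X₁ ^ 2 + X₂ ^ 2) * combo a b (point o₁ o₂ o₃ X₁ X₂ Y₁ Y₂ z₁ z₂) =
      -((X₁ ^ 2 + X₂ ^ 2) * o₃
          - 2 * (z₁ * (o₁ * X₁ + o₂ * X₂) - z₂ * (o₂ * X₁ - o₁ * X₂))) ^ 2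
        + 2 * (a ^ 2 - b ^ 2) * ((o₁ * X₁ + o₂ * X₂) ^ 2 - (o₂ * X₁ - o₁ * X₂) ^ 2
          + (X₁ ^ 2 + X₂ ^ 2) * X₁) := by
  have hc := combo_point hx
  obtain ⟨h₁, h₂, -⟩ := point_mem_phaseSpace.1 hx
  linear_combination (X₁ ^ 2 + X₂ ^ 2) * hc
    + 2 * ((o₁ * X₁ + o₂ * X₂) ^ 2 - (o₂ * X₁ - o₁ * X₂) ^ 2) * h₁
    - 4 * (o₁ * X₁ + o₂ * X₂) * (o₂ * X₁ - o₁ * X₂) * h₂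

/-- The equations of the critical subsystem at a point with `(α₁ - β₂)² + (α₂ + β₁)² ≠ 0`. -/
structure RegularEqs (a b m o₁ o₂ o₃ X₁ X₂ z₁ z₂ : ℝ) : Prop where
  ω₃ : (X₁ ^ 2 + X₂ ^ 2) * o₃ = 2 * (z₁ * (o₁ * X₁ + o₂ * X₂) - z₂ * (o₂ * X₁ - o₁ * X₂))
  re : (o₁ * X₁ + o₂ * X₂) ^ 2 - (o₂ * X₁ - o₁ * X₂) ^ 2 + (X₁ ^ 2 + X₂ ^ 2) * X₁ =
    (X₁ ^ 2 + X₂ ^ 2) * ((a ^ 2 - b ^ 2) * m)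
  im : 2 * (o₁ * X₁ + o₂ * X₂) * (o₂ * X₁ - o₁ * X₂) = (X₁ ^ 2 + X₂ ^ 2) * X₂

/-- This explains the role of L₀: the factor 2mH + 1 + 2p²m² is the left side of its equation, so
over L₀ the square on the left is zero. -/
theorem RegularEqs.H_relation (hρ : X₁ ^ 2 + X₂ ^ 2 ≠ 0)
    (hx : point o₁ o₂ o₃ X₁ X₂ Y₁ Y₂ z₁ z₂ ∈ phaseSpace a b)
    (e : RegularEqs a b m o₁ o₂ o₃ X₁ X₂ z₁ z₂) :
    (o₁ ^ 2 + o₂ ^ 2 + m * (X₁ ^ 2 + X₂ ^ 2 + z₁ ^ 2 + z₂ ^ 2)) ^ 2 =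
      (X₁ ^ 2 + X₂ ^ 2) * (2 * m * (o₁ ^ 2 + o₂ ^ 2 + o₃ ^ 2 / 2 - Y₁) + 1
        + 2 * (a ^ 2 + b ^ 2) * m ^ 2) := by
  obtain ⟨h₁, h₂, h₃⟩ := point_mem_phaseSpace.1 hx
  obtain ⟨e₁, e₂, e₃⟩ := e
  set r := a ^ 2 - b ^ 2 with hr
  -- Squared moduli in g² = |X|²(r²m − X̄), where g = w X̄. The local `r` stands for r².
  have hw : (o₁ ^ 2 + o₂ ^ 2) ^ 2 = (r * m - X₁) ^ 2 + X₂ ^ 2 := by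
    apply mul_left_cancel₀ (pow_ne_zero 2 hρ)
    linear_combination (((o₁ * X₁ + o₂ * X₂) ^ 2 - (o₂ * X₁ - o₁ * X₂) ^ 2)
        + (X₁ ^ 2 + X₂ ^ 2) * (r * m - X₁)) * e₂
      + (2 * (o₁ * X₁ + o₂ * X₂) * (o₂ * X₁ - o₁ * X₂) + (X₁ ^ 2 + X₂ ^ 2) * X₂) * e₃
  -- Square the ω₃-equation and use 2(Re zg)² = Re(z²g²) + |z|²|g|².
  have ho : (X₁ ^ 2 + X₂ ^ 2) * o₃ ^ 2 = 2 * ((z₁ ^ 2 - z₂ ^ 2) * (r * m - X₁)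
      - 2 * z₁ * z₂ * X₂ + (z₁ ^ 2 + z₂ ^ 2) * (o₁ ^ 2 + o₂ ^ 2)) := by
    apply mul_left_cancel₀ hρ
    linear_combination ((X₁ ^ 2 + X₂ ^ 2) * o₃
        + 2 * (z₁ * (o₁ * X₁ + o₂ * X₂) - z₂ * (o₂ * X₁ - o₁ * X₂))) * e₁
      + 2 * (z₁ ^ 2 - z₂ ^ 2) * e₂ - 4 * z₁ * z₂ * e₃
  linear_combination hw - m * ho + 2 * m * (X₁ * h₁ + X₂ * h₂)
    + m ^ 2 * ((X₁ ^ 2 + X₂ ^ 2) * h₃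
      - (r - (z₁ ^ 2 - z₂ ^ 2) + (X₁ * Y₁ + X₂ * Y₂)) * h₁
      + (2 * z₁ * z₂ + (X₁ * Y₂ - X₂ * Y₁)) * h₂)

/-- In the completed-square form of |X|²(2G − p²H) the square has zero differential, since its base
vanishes. What remains is matched with dK through w² + X = r²mX²/|X|². -/
theorem RegularEqs.fderiv_eq_zero (hρ : X₁ ^ 2 + X₂ ^ 2 ≠ 0)
    (hx : point o₁ o₂ o₃ X₁ X₂ Y₁ Y₂ z₁ z₂ ∈ phaseSpace a b)
    (e : RegularEqs a b m o₁ o₂ o₃ X₁ X₂ z₁ z₂)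
    (hA : combo a b (point o₁ o₂ o₃ X₁ X₂ Y₁ Y₂ z₁ z₂) = (a ^ 2 - b ^ 2) ^ 2 * m)
    (hv : fderiv ℝ casimir (point o₁ o₂ o₃ X₁ X₂ Y₁ Y₂ z₁ z₂)
        (point d₁ d₂ d₃ dX₁ dX₂ dY₁ dY₂ dz₁ dz₂) = 0) :
    fderiv ℝ (F a b) (point o₁ o₂ o₃ X₁ X₂ Y₁ Y₂ z₁ z₂)
        (point d₁ d₂ d₃ dX₁ dX₂ dY₁ dY₂ dz₁ dz₂) = 0 := by
  have hc := combo_point hx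
  obtain ⟨h₁, h₂, h₃⟩ := point_mem_phaseSpace.1 hx
  obtain ⟨t₁, t₂, t₃⟩ := fderiv_casimir_point.1 hv
  obtain ⟨e₁, e₂, e₃⟩ := e
  rw [fderiv_F, dcombo_point hx hv, dK_point, hA]
  rw [hA] at hc
  set r := a ^ 2 - b ^ 2 with hr
  have q₁ : X₁ * (o₁ ^ 2 - o₂ ^ 2 + X₁) + X₂ * (2 * o₁ * o₂ + X₂) = r * m * X₁ := by
    apply mul_left_cancel₀ hρ
    linear_combination X₁ * e₂ - X₂ * e₃
  have q₂ : X₁ * (2 * o₁ * o₂ + X₂) - X₂ * (o₁ ^ 2 - o₂ ^ 2 + X₁) = r * m * X₂ := by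
    apply mul_left_cancel₀ hρ
    linear_combination X₂ * e₂ + X₁ * e₃
  have k₁ : (X₁ ^ 2 + X₂ ^ 2) * (o₁ ^ 2 - o₂ ^ 2 + X₁) = r * m * (X₁ ^ 2 - X₂ ^ 2) := by
    linear_combination X₁ * q₁ - X₂ * q₂
  have k₂ : (X₁ ^ 2 + X₂ ^ 2) * (2 * o₁ * o₂ + X₂) = r * m * (2 * X₁ * X₂) := by
    linear_combination X₂ * q₁ + X₁ * q₂
  apply mul_left_cancel₀ hρ
  linear_combination 2 * r ^ 2 * m * (
      ((o₁ * X₁ + o₂ * X₂) ^ 2 - (o₂ * X₁ - o₁ * X₂) ^ 2) * t₁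
      + (2 * (o₁ * X₁ + o₂ * X₂) * (d₁ * X₁ + o₁ * dX₁ + d₂ * X₂ + o₂ * dX₂)
        - 2 * (o₂ * X₁ - o₁ * X₂) * (d₂ * X₁ + o₂ * dX₁ - d₁ * X₂ - o₁ * dX₂)) * h₁
      - 2 * (o₁ * X₁ + o₂ * X₂) * (o₂ * X₁ - o₁ * X₂) * t₂
      - 2 * ((d₁ * X₁ + o₁ * dX₁ + d₂ * X₂ + o₂ * dX₂) * (o₂ * X₁ - o₁ * X₂)
        + (o₁ * X₁ + o₂ * X₂) * (d₂ * X₁ + o₂ * dX₁ - d₁ * X₂ - o₁ * dX₂)) * h₂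
      - (2 * (X₁ * dX₁ + X₂ * dX₂) * o₃ + (X₁ ^ 2 + X₂ ^ 2) * d₃
        - 2 * (dz₁ * (o₁ * X₁ + o₂ * X₂)
          + z₁ * (d₁ * X₁ + o₁ * dX₁ + d₂ * X₂ + o₂ * dX₂)
          - dz₂ * (o₂ * X₁ - o₁ * X₂)
          - z₂ * (d₂ * X₁ + o₂ * dX₁ - d₁ * X₂ - o₁ * dX₂))) * e₁
      + (X₁ * dX₁ + X₂ * dX₂) * hc
      + 2 * r * (dX₁ * q₁ + dX₂ * q₂))
    - r ^ 2 * (2 * (2 * o₁ * d₁ - 2 * o₂ * d₂ + dX₁) * k₁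
      + 2 * (2 * d₁ * o₂ + 2 * o₁ * d₂ + dX₂) * k₂)

theorem mem_integralManifold_regular (hab : a ^ 2 - b ^ 2 ≠ 0) (hL : (m, h) ∈ L0 a b)
    (hρ : X₁ ^ 2 + X₂ ^ 2 ≠ 0) :
    point o₁ o₂ o₃ X₁ X₂ Y₁ Y₂ z₁ z₂ ∈ integralManifold a b m h ↔
      point o₁ o₂ o₃ X₁ X₂ Y₁ Y₂ z₁ z₂ ∈ phaseSpace a b ∧
      RegularEqs a b m o₁ o₂ o₃ X₁ X₂ z₁ z₂ ∧
      o₁ ^ 2 + o₂ ^ 2 = -m * (X₁ ^ 2 + X₂ ^ 2 + z₁ ^ 2 + z₂ ^ 2) := by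
  obtain ⟨hL, hm⟩ := hL
  simp only at hL hm
  rw [mem_integralManifold_iff hab]
  constructor
  · rintro ⟨hx, hF, hd, hA, hH⟩
    have hA0 : combo a b (point o₁ o₂ o₃ X₁ X₂ Y₁ Y₂ z₁ z₂) ≠ 0 := by
      rw [hA]
      exact mul_ne_zero (pow_ne_zero 2 hab) hm.ne
    -- The ω₃-direction is tangent to 𝒫 and K does not involve ω₃, so criticality of F forces ∂(2G −
    -- p²H)/∂ω₃ = 0, because m ≠ 0.
    have hv : fderiv ℝ casimir (point o₁ o₂ o₃ X₁ X₂ Y₁ Y₂ z₁ z₂) (point 0 0 1 0 0 0 0 0 0) = 0 :=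
      fderiv_casimir_point.2 (by simp)
    have e₁ : (X₁ ^ 2 + X₂ ^ 2) * o₃ =
        2 * (z₁ * (o₁ * X₁ + o₂ * X₂) - z₂ * (o₂ * X₁ - o₁ * X₂)) := by
      have h₀ := hd _ hv
      rw [fderiv_F, dcombo_point hx hv, dK_point] at h₀
      apply mul_left_cancel₀ hA0
      linear_combination -h₀ / 2
    have e₂ : (o₁ * X₁ + o₂ * X₂) ^ 2 - (o₂ * X₁ - o₁ * X₂) ^ 2 + (X₁ ^ 2 + X₂ ^ 2) * X₁ =
        (X₁ ^ 2 + X₂ ^ 2) * ((a ^ 2 - b ^ 2) * m) := by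
      have h₀ := normSq_mul_combo_point hx
      rw [hA, sub_eq_zero.2 e₁] at h₀
      apply mul_left_cancel₀ hab
      linear_combination -h₀ / 2
    have e₃ : 2 * (o₁ * X₁ + o₂ * X₂) * (o₂ * X₁ - o₁ * X₂) = (X₁ ^ 2 + X₂ ^ 2) * X₂ := by
      rw [hA, K_point] at hF
      have hK : (a ^ 2 - b ^ 2) ^ 2 * m ^ 2 =
          (o₁ ^ 2 - o₂ ^ 2 + X₁) ^ 2 + (2 * o₁ * o₂ + X₂) ^ 2 := by
        apply mul_left_cancel₀ (pow_ne_zero 2 hab)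
        linear_combination hF
      -- The number (w² + X)X̄/X has modulus r²|m| by F = 0 and real part r²m by the previous
      -- equation, so its imaginary part is zero.
      rw [← sub_eq_zero, ← sq_eq_zero_iff]
      linear_combination -(X₁ ^ 2 + X₂ ^ 2) ^ 2 * hK
        - ((o₁ * X₁ + o₂ * X₂) ^ 2 - (o₂ * X₁ - o₁ * X₂) ^ 2 + (X₁ ^ 2 + X₂ ^ 2) * X₁
          + (X₁ ^ 2 + X₂ ^ 2) * ((a ^ 2 - b ^ 2) * m)) * e₂
    have e : RegularEqs a b m o₁ o₂ o₃ X₁ X₂ z₁ z₂ := ⟨e₁, e₂, e₃⟩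
    refine ⟨hx, e, ?_⟩
    have h₀ := e.H_relation hρ hx
    rw [H_point] at hH
    rw [hH, show 2 * m * h + 1 + 2 * (a ^ 2 + b ^ 2) * m ^ 2 = 0 by linear_combination hL,
      mul_zero, sq_eq_zero_iff] at h₀
    linear_combination h₀
  · rintro ⟨hx, e, hl⟩
    have hA : combo a b (point o₁ o₂ o₃ X₁ X₂ Y₁ Y₂ z₁ z₂) = (a ^ 2 - b ^ 2) ^ 2 * m := by
      have h₀ := normSq_mul_combo_point hx
      rw [e.re, sub_eq_zero.2 e.ω₃] at h₀
      apply mul_left_cancel₀ hρ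
      linear_combination h₀ / 2
    refine ⟨hx, ?_, fun v hv => ?_, hA, ?_⟩
    · rw [hA, K_point]
      apply mul_left_cancel₀ (pow_ne_zero 2 hρ)
      linear_combination -(a ^ 2 - b ^ 2) ^ 2 * (
        ((o₁ * X₁ + o₂ * X₂) ^ 2 - (o₂ * X₁ - o₁ * X₂) ^ 2 + (X₁ ^ 2 + X₂ ^ 2) * X₁
          + (X₁ ^ 2 + X₂ ^ 2) * ((a ^ 2 - b ^ 2) * m)) * e.re
        + (2 * (o₁ * X₁ + o₂ * X₂) * (o₂ * X₁ - o₁ * X₂) - (X₁ ^ 2 + X₂ ^ 2) * X₂) * e.im)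
    · obtain ⟨d₁, d₂, d₃, dX₁, dX₂, dY₁, dY₂, dz₁, dz₂, rfl⟩ := exists_point v
      exact e.fderiv_eq_zero hρ hx hA hv
    · have h₀ := e.H_relation hρ hx
      rw [hl] at h₀
      rw [H_point]
      have : 2 * m * (o₁ ^ 2 + o₂ ^ 2 + o₃ ^ 2 / 2 - Y₁) + 1 + 2 * (a ^ 2 + b ^ 2) * m ^ 2 = 0 := by
        apply mul_left_cancel₀ hρ
        rw [hl]
        linear_combination -h₀
      apply mul_left_cancel₀ (mul_ne_zero two_ne_zero hm.ne)
      linear_combination this - hL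

/-- The equations of the critical subsystem at a point with `α₁ = β₂`, `α₂ = -β₁`. -/
structure SingularEqs (a b m h o₁ o₂ o₃ Y₁ Y₂ z₁ z₂ : ℝ) : Prop where
  β₃ : z₂ = 0
  α₃ : z₁ ^ 2 = a ^ 2 - b ^ 2
  normSq : Y₁ ^ 2 + Y₂ ^ 2 = 4 * b ^ 2
  normSq_ω : o₁ ^ 2 + o₂ ^ 2 = -m * (a ^ 2 - b ^ 2)
  crit : m * (z₁ * o₃ + Y₁ * o₁ + Y₂ * o₂) = o₁
  energy : o₁ ^ 2 + o₂ ^ 2 + o₃ ^ 2 / 2 - Y₁ = h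

theorem mem_integralManifold_singular (hab : 0 < a ^ 2 - b ^ 2) (hm : m < 0) :
    point o₁ o₂ o₃ 0 0 Y₁ Y₂ z₁ z₂ ∈ integralManifold a b m h ↔
      SingularEqs a b m h o₁ o₂ o₃ Y₁ Y₂ z₁ z₂ := by
  have hP : point o₁ o₂ o₃ 0 0 Y₁ Y₂ z₁ z₂ ∈ phaseSpace a b ↔
      z₂ = 0 ∧ z₁ ^ 2 = a ^ 2 - b ^ 2 ∧ Y₁ ^ 2 + Y₂ ^ 2 = 4 * b ^ 2 := by
    rw [point_mem_phaseSpace]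
    constructor
    · rintro ⟨h₁, h₂, h₃⟩
      have : z₂ = 0 := by
        have : z₁ * z₂ = 0 := by linear_combination h₂ / 2
        rcases mul_eq_zero.1 this with rfl | h
        · nlinarith [sq_nonneg z₂]
        · exact h
      subst this
      exact ⟨rfl, by linear_combination h₁, by linear_combination h₃ - 2 * h₁⟩
    · rintro ⟨rfl, h₁, h₂⟩
      exact ⟨by linear_combination h₁, by ring, by linear_combination h₂ + 2 * h₁⟩
  rw [mem_integralManifold_iff hab.ne', H_point]
  constructor
  · rintro ⟨hx, -, hd, hA, hH⟩
    obtain ⟨rfl, hz, hY⟩ := hP.1 hx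
    have hc := combo_point hx
    rw [hA] at hc
    have hw : o₁ ^ 2 + o₂ ^ 2 = -m * (a ^ 2 - b ^ 2) := by
      apply mul_left_cancel₀ hab.ne'
      linear_combination hc / 2 - (o₁ ^ 2 + o₂ ^ 2) * hz
    have hw0 : o₁ ^ 2 + o₂ ^ 2 ≠ 0 := by
      rw [hw]
      exact (mul_pos (neg_pos.2 hm) hab).ne'
    refine ⟨rfl, hz, hY, hw, ?_, hH⟩
    -- Tangent vectors that move X off 0: (dX, dY, dz) = (2z₁, 2z₁, −Ȳ) and its multiple by i. They
    -- give the `crit` equation multiplied by ω₁ and by ω₂, and w ≠ 0.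
    have hv₁ : fderiv ℝ casimir (point o₁ o₂ o₃ 0 0 Y₁ Y₂ z₁ 0)
        (point 0 0 0 (2 * z₁) 0 (2 * z₁) 0 (-Y₁) Y₂) = 0 :=
      fderiv_casimir_point.2 ⟨by ring, by ring, by ring⟩
    have hv₂ : fderiv ℝ casimir (point o₁ o₂ o₃ 0 0 Y₁ Y₂ z₁ 0)
        (point 0 0 0 0 (2 * z₁) 0 (2 * z₁) (-Y₂) (-Y₁)) = 0 :=
      fderiv_casimir_point.2 ⟨by ring, by ring, by ring⟩
    have f₁ := hd _ hv₁
    have f₂ := hd _ hv₂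
    rw [fderiv_F, dcombo_point hx hv₁, dK_point, hA] at f₁
    rw [fderiv_F, dcombo_point hx hv₂, dK_point, hA] at f₂
    have hz0 : z₁ ≠ 0 := fun h => hab.ne' (by rw [← hz, h]; ring)
    have hc0 : 8 * (a ^ 2 - b ^ 2) ^ 2 * z₁ ≠ 0 :=
      mul_ne_zero (mul_ne_zero (by norm_num) (pow_ne_zero 2 hab.ne')) hz0
    have g₁ : o₁ * (m * (z₁ * o₃ + Y₁ * o₁ + Y₂ * o₂) - o₁) = 0 := by
      apply mul_left_cancel₀ hc0
      linear_combination f₁ - 4 * (a ^ 2 - b ^ 2) ^ 2 * z₁ * hw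
    have g₂ : o₂ * (m * (z₁ * o₃ + Y₁ * o₁ + Y₂ * o₂) - o₁) = 0 := by
      apply mul_left_cancel₀ hc0
      linear_combination f₂
    apply mul_left_cancel₀ hw0
    linear_combination o₁ * g₁ + o₂ * g₂
  · rintro ⟨rfl, hz, hY, hw, hω, hH⟩
    have hx := hP.2 ⟨rfl, hz, hY⟩
    have hc := combo_point hx
    have hA : combo a b (point o₁ o₂ o₃ 0 0 Y₁ Y₂ z₁ 0) = (a ^ 2 - b ^ 2) ^ 2 * m := by
      linear_combination hc / 2 - (a ^ 2 - b ^ 2) * hw - (o₁ ^ 2 + o₂ ^ 2) * hz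
    refine ⟨hx, ?_, fun v hv => ?_, hA, hH⟩
    · rw [hA, K_point]
      linear_combination (-(a ^ 2 - b ^ 2) ^ 2) * (o₁ ^ 2 + o₂ ^ 2 - m * (a ^ 2 - b ^ 2)) * hw
    · obtain ⟨d₁, d₂, d₃, dX₁, dX₂, dY₁, dY₂, dz₁, dz₂, rfl⟩ := exists_point v
      obtain ⟨t₁, t₂, t₃⟩ := fderiv_casimir_point.1 hv
      rw [fderiv_F, dcombo_point hx hv, dK_point, hA]
      linear_combination (a ^ 2 - b ^ 2) ^ 2 * (4 * (o₁ * dX₁ + o₂ * dX₂) * hω + 2 * dX₁ * hw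
        - 4 * m * (o₁ * d₁ + o₂ * d₂) * hz - 4 * (o₁ * d₁ + o₂ * d₂) * hw
        - 2 * m * (o₁ ^ 2 + o₂ ^ 2) * t₁)

end

/-! ### The parametrization by Γ₁ × Γ₂ -/

/-- The parametrization of the integral manifold over `L₀` by the product of the curves. -/
def param (a b m h : ℝ) : (ℝ × ℝ × ℝ) × (ℝ × ℝ × ℝ) → Ambient :=
  fun ((u₁, Q₁, P₁), (u₂, Q₂, P₂)) =>
    let r := √(a ^ 2 - b ^ 2)
    let i := (a - b * u₁ * u₂)⁻¹
    let E₁ := m * a * b * u₂ - hStar a b m h * u₁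
    let E₂ := P₁ * P₂
    let N₁ := 2 * a * b * u₂ - (a ^ 2 + b ^ 2) * u₁
    let N₂ := 2 * a * b * Q₁ * Q₂
    point (-2 * r * m * a * P₂ * i) (-2 * r * m * b * u₂ * P₁ * i)
      (-2 * (a * Q₁ * P₂ + b * Q₂ * P₁) * i)
      (-2 * (a ^ 2 - b ^ 2) * u₁ * E₁ * i ^ 2) (-2 * (a ^ 2 - b ^ 2) * u₁ * E₂ * i ^ 2)
      (2 * (N₁ * E₁ + N₂ * E₂) * i ^ 2) (2 * (N₁ * E₂ - N₂ * E₁) * i ^ 2)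
      (r * a * Q₁ * i) (r * b * Q₂ * u₁ * i)

theorem denominator_pos {a b u₁ Q₁ u₂ Q₂ : ℝ} (hb : 0 < b) (hab : b < a)
    (h₁ : Q₁ ^ 2 + u₁ ^ 2 = 1) (h₂ : Q₂ ^ 2 + u₂ ^ 2 = 1) : 0 < a - b * u₁ * u₂ := by
  have : u₁ * u₂ ≤ 1 := by nlinarith [sq_nonneg (u₁ - u₂), sq_nonneg Q₁, sq_nonneg Q₂]
  nlinarith

section

variable {a b m h : ℝ}

theorem sq_sub_sq_pos (hb : 0 < b) (hab : b < a) : 0 < a ^ 2 - b ^ 2 := by nlinarith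

/-- With E = E₁ + iE₂, N = N₁ + iN₂ and D = a − bu₁u₂, the formulas read X = −2r²u₁E/D² and Y =
2N̄E/D². Since |E| = D/2, this gives |X| = r²|u₁|/D and XȲ = −r²u₁N/D², so the locus X = 0
corresponds to u₁ = 0. -/
theorem param_mem (hb : 0 < b) (hab : b < a) (hL : (m, h) ∈ L0 a b)
    {p : (ℝ × ℝ × ℝ) × (ℝ × ℝ × ℝ)} (hp : p ∈ Gamma1 a b 0 m h ×ˢ Gamma2 a b 0 m h) :
    param a b m h p ∈ integralManifold a b m h := by
  obtain ⟨⟨u₁, Q₁, P₁⟩, ⟨u₂, Q₂, P₂⟩⟩ := p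
  obtain ⟨⟨hQ₁, hP₁⟩, ⟨hQ₂, hP₂⟩⟩ := hp
  have hk := four_mul_hStar hL
  have hkdef : 2 * hStar a b m h = -(h + (a ^ 2 + b ^ 2) * m) := by unfold hStar; ring
  have hr2 := sq_sub_sq_pos hb hab
  have hr : √(a ^ 2 - b ^ 2) ^ 2 = a ^ 2 - b ^ 2 := Real.sq_sqrt hr2.le
  have hD := denominator_pos hb hab hQ₁ hQ₂
  have hi : (a - b * u₁ * u₂) * (a - b * u₁ * u₂)⁻¹ = 1 := mul_inv_cancel₀ hD.ne'
  have hi0 : (a - b * u₁ * u₂)⁻¹ ≠ 0 := inv_ne_zero hD.ne'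
  unfold param
  simp only
  set r := √(a ^ 2 - b ^ 2)
  set k := hStar a b m h
  set i := (a - b * u₁ * u₂)⁻¹
  have hi2 : (a - b * u₁ * u₂) ^ 2 * i ^ 2 = 1 := by rw [← mul_pow, hi, one_pow]
  -- Multiplying the two curve equations gives E₁² + E₂² = m h_*(a − bu₁u₂)², and m h_* = 1/4 on L₀.
  have hE : ((m * a * b * u₂ - k * u₁) ^ 2 + (P₁ * P₂) ^ 2) * i ^ 2 = 1 / 4 := by
    have : (m * a * b * u₂ - k * u₁) ^ 2 + (P₁ * P₂) ^ 2 = (a - b * u₁ * u₂) ^ 2 / 4 := by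
      linear_combination P₂ ^ 2 * hP₁ + (k * u₁ ^ 2 - a ^ 2 * m) * hP₂
        + (a - b * u₁ * u₂) ^ 2 / 4 * hk
    rw [this]
    linear_combination hi2 / 4
  rcases eq_or_ne u₁ 0 with rfl | hu
  · have hia : a * i = 1 := by linear_combination hi
    have hia2 : a ^ 2 * i ^ 2 = 1 := by rw [← mul_pow, hia, one_pow]
    have hQ : Q₁ ^ 2 = 1 := by linear_combination hQ₁
    have hP : P₁ ^ 2 = -a ^ 2 * m := by linear_combination hP₁
    have e : SingularEqs a b m h (-2 * r * m * a * P₂ * i) (-2 * r * m * b * u₂ * P₁ * i)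
        (-2 * (a * Q₁ * P₂ + b * Q₂ * P₁) * i)
        (2 * ((2 * a * b * u₂ - (a ^ 2 + b ^ 2) * 0) * (m * a * b * u₂ - k * 0)
          + 2 * a * b * Q₁ * Q₂ * (P₁ * P₂)) * i ^ 2)
        (2 * ((2 * a * b * u₂ - (a ^ 2 + b ^ 2) * 0) * (P₁ * P₂)
          - 2 * a * b * Q₁ * Q₂ * (m * a * b * u₂ - k * 0)) * i ^ 2)
        (r * a * Q₁ * i) (r * b * Q₂ * 0 * i) := by
      have hw : (-2 * r * m * a * P₂ * i) ^ 2 + (-2 * r * m * b * u₂ * P₁ * i) ^ 2 =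
          -m * (a ^ 2 - b ^ 2) := by
        linear_combination 4 * m ^ 2 * i ^ 2 * (a ^ 2 * P₂ ^ 2 + b ^ 2 * u₂ ^ 2 * P₁ ^ 2) * hr
          + 4 * (a ^ 2 - b ^ 2) * m ^ 2 * i ^ 2 * (a ^ 2 * hP₂ + b ^ 2 * u₂ ^ 2 * hP)
          - m * (a ^ 2 - b ^ 2) * (a ^ 2 * i ^ 2 * hk + hia2)
      refine ⟨by ring, ?_, ?_, hw, ?_, ?_⟩
      · linear_combination a ^ 2 * Q₁ ^ 2 * i ^ 2 * hr + (a ^ 2 - b ^ 2) * (a ^ 2 * i ^ 2 * hQ + hia2)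
      · linear_combination 4 * i ^ 2 * (4 * a ^ 2 * b ^ 2 * (u₂ ^ 2 + Q₁ ^ 2 * Q₂ ^ 2)) * hE
          + 4 * a ^ 2 * b ^ 2 * i ^ 2 * (Q₂ ^ 2 * hQ + hQ₂) + 4 * b ^ 2 * hia2
      · linear_combination m * (-4 * r * m * i ^ 3 * (2 * a * b * u₂ * P₂ * b * u₂ * hP
            + (2 * a * b * Q₁ * Q₂) * P₁ * a * hP₂)
          + r * a * i ^ 3 * (2 * a * b * Q₁ * Q₂) * P₁ * hk + r * i ^ 2 * (2 * a * b * Q₁ * Q₂) * P₁ * hia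
          - 2 * r * a ^ 2 * P₂ * i ^ 2 * hQ - 2 * r * a * i * P₂ * hia)
      · rw [hw]
        linear_combination 2 * i ^ 2 * a ^ 2 * P₂ ^ 2 * hQ + 2 * i ^ 2 * a ^ 2 * hP₂
          + 2 * i ^ 2 * b ^ 2 * Q₂ ^ 2 * hP - 2 * b ^ 2 * m * i ^ 2 * a ^ 2 * hQ₂
          - (2 * k + 2 * b ^ 2 * m) * hia2 - hkdef
    have := (mem_integralManifold_singular hr2 hL.2).2 e
    convert this using 2 <;> ring
  have hX : (-2 * (a ^ 2 - b ^ 2) * u₁ * (m * a * b * u₂ - k * u₁) * i ^ 2) ^ 2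
      + (-2 * (a ^ 2 - b ^ 2) * u₁ * (P₁ * P₂) * i ^ 2) ^ 2 =
      (a ^ 2 - b ^ 2) ^ 2 * u₁ ^ 2 * i ^ 2 := by
    linear_combination 4 * (a ^ 2 - b ^ 2) ^ 2 * u₁ ^ 2 * i ^ 2 * hE
  have hρ : (-2 * (a ^ 2 - b ^ 2) * u₁ * (m * a * b * u₂ - k * u₁) * i ^ 2) ^ 2
      + (-2 * (a ^ 2 - b ^ 2) * u₁ * (P₁ * P₂) * i ^ 2) ^ 2 ≠ 0 := by
    rw [hX]
    have := hr2.ne'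
    positivity
  -- On the curves, w X̄ collapses to r³u₁(−u₁P₂ + iP₁)/D².
  have g₁ : -2 * r * m * a * P₂ * i * (-2 * (a ^ 2 - b ^ 2) * u₁ * (m * a * b * u₂ - k * u₁) * i ^ 2)
      + -2 * r * m * b * u₂ * P₁ * i * (-2 * (a ^ 2 - b ^ 2) * u₁ * (P₁ * P₂) * i ^ 2) =
      -r * (a ^ 2 - b ^ 2) * u₁ ^ 2 * P₂ * i ^ 2 := by
    linear_combination 4 * r * (a ^ 2 - b ^ 2) * m * u₁ * i ^ 3 * (b * u₂ * P₂) * hP₁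
      - r * (a ^ 2 - b ^ 2) * u₁ ^ 2 * P₂ * i ^ 2 * (4 * m * k * hi + hk)
  have g₂ : -2 * r * m * b * u₂ * P₁ * i * (-2 * (a ^ 2 - b ^ 2) * u₁ * (m * a * b * u₂ - k * u₁) * i ^ 2)
      - -2 * r * m * a * P₂ * i * (-2 * (a ^ 2 - b ^ 2) * u₁ * (P₁ * P₂) * i ^ 2) =
      r * (a ^ 2 - b ^ 2) * u₁ * P₁ * i ^ 2 := by
    linear_combination -4 * r * (a ^ 2 - b ^ 2) * m * u₁ * i ^ 3 * (a * P₁) * hP₂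
      + r * (a ^ 2 - b ^ 2) * u₁ * P₁ * i ^ 2 * (4 * m * k * hi + hk)
  rw [mem_integralManifold_regular hr2.ne' hL hρ, point_mem_phaseSpace]
  refine ⟨⟨?_, ?_, ?_⟩, ⟨?_, ?_, ?_⟩, ?_⟩
  · linear_combination i ^ 2 * (a ^ 2 * Q₁ ^ 2 - b ^ 2 * Q₂ ^ 2 * u₁ ^ 2) * hr
      - 4 * (a ^ 2 - b ^ 2) * u₁ * (2 * a * b * u₂ - (a ^ 2 + b ^ 2) * u₁) * i ^ 2 * hE
      + (a ^ 2 - b ^ 2) * i ^ 2 * (a ^ 2 * hQ₁ - b ^ 2 * u₁ ^ 2 * hQ₂) + (a ^ 2 - b ^ 2) * hi2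
  · linear_combination 2 * a * b * Q₁ * Q₂ * u₁ * i ^ 2 * hr
      - 4 * (a ^ 2 - b ^ 2) * u₁ * (2 * a * b * Q₁ * Q₂) * i ^ 2 * hE
  · linear_combination 4 * i ^ 2 * ((a ^ 2 - b ^ 2) ^ 2 * u₁ ^ 2
        + (2 * a * b * u₂ - (a ^ 2 + b ^ 2) * u₁) ^ 2 + (2 * a * b * Q₁ * Q₂) ^ 2) * hE
      + 2 * i ^ 2 * (a ^ 2 * Q₁ ^ 2 + b ^ 2 * Q₂ ^ 2 * u₁ ^ 2) * hr
      + i ^ 2 * (4 * a ^ 2 * b ^ 2 * (Q₂ ^ 2 * hQ₁ + (1 - u₁ ^ 2) * hQ₂)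
        + 2 * (a ^ 2 - b ^ 2) * (a ^ 2 * hQ₁ + b ^ 2 * u₁ ^ 2 * hQ₂))
      + 2 * (a ^ 2 + b ^ 2) * hi2
  · rw [g₁, g₂, hX]
    linear_combination 2 * (a ^ 2 - b ^ 2) * u₁ ^ 2 * i ^ 3 * (a * Q₁ * P₂ + b * Q₂ * P₁) * hr
  · rw [g₁, g₂, hX]
    linear_combination (a ^ 2 - b ^ 2) ^ 2 * u₁ ^ 2 * i ^ 4 * (u₁ ^ 2 * P₂ ^ 2 - P₁ ^ 2) * hr
      + (a ^ 2 - b ^ 2) ^ 3 * u₁ ^ 2 * i ^ 4 * (u₁ ^ 2 * hP₂ - hP₁)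
      + (a ^ 2 - b ^ 2) ^ 3 * u₁ ^ 2 * i ^ 2 * m * hi2
  · rw [g₁, g₂, hX]
    linear_combination -2 * (a ^ 2 - b ^ 2) ^ 2 * u₁ ^ 3 * P₁ * P₂ * i ^ 4 * hr
  · rw [hX]
    linear_combination 4 * m ^ 2 * i ^ 2 * (a ^ 2 * P₂ ^ 2 + b ^ 2 * u₂ ^ 2 * P₁ ^ 2) * hr
      + 4 * (a ^ 2 - b ^ 2) * m ^ 2 * i ^ 2 * (a ^ 2 * hP₂ + b ^ 2 * u₂ ^ 2 * hP₁)
      + m * (a ^ 2 - b ^ 2) * i ^ 2 * (b ^ 2 * u₁ ^ 2 * u₂ ^ 2 - a ^ 2) * hk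
      + m * i ^ 2 * (a ^ 2 * Q₁ ^ 2 + b ^ 2 * Q₂ ^ 2 * u₁ ^ 2) * hr
      + m * (a ^ 2 - b ^ 2) * i ^ 2 * (a ^ 2 * hQ₁ + b ^ 2 * u₁ ^ 2 * hQ₂)

end

/-! ### Fibres of the parametrization -/

theorem point_inj {o₁ o₂ o₃ X₁ X₂ Y₁ Y₂ z₁ z₂ o₁' o₂' o₃' X₁' X₂' Y₁' Y₂' z₁' z₂' : ℝ} :
    point o₁ o₂ o₃ X₁ X₂ Y₁ Y₂ z₁ z₂ = point o₁' o₂' o₃' X₁' X₂' Y₁' Y₂' z₁' z₂' ↔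
      o₁ = o₁' ∧ o₂ = o₂' ∧ o₃ = o₃' ∧ X₁ = X₁' ∧ X₂ = X₂' ∧ Y₁ = Y₁' ∧ Y₂ = Y₂' ∧
        z₁ = z₁' ∧ z₂ = z₂' := by
  constructor
  · intro e
    have e₀ := fun i => congrFun (congrArg (fun x : Ambient => x.1) e) i
    have e₁ := fun i => congrFun (congrArg (fun x : Ambient => x.2.1) e) i
    have e₂ := fun i => congrFun (congrArg (fun x : Ambient => x.2.2) e) i
    have a₀ := e₁ 0
    have a₁ := e₁ 1
    have b₀ := e₂ 0
    have b₁ := e₂ 1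
    simp only [point, Matrix.cons_val] at a₀ a₁ b₀ b₁
    refine ⟨e₀ 0, e₀ 1, e₀ 2, ?_, ?_, ?_, ?_, e₁ 2, e₂ 2⟩ <;> linarith
  · rintro ⟨rfl, rfl, rfl, rfl, rfl, rfl, rfl, rfl, rfl⟩
    rfl

/-- A tensor product of a nonzero vector and a unit vector of the plane determines its factors up
to a common sign. -/
theorem eq_or_eq_neg_of_tensor_eq {u P v Q u' P' v' Q' : ℝ} (h : u ≠ 0 ∨ P ≠ 0)
    (h₁ : Q ^ 2 + v ^ 2 = 1) (h₂ : Q' ^ 2 + v' ^ 2 = 1) (e₁ : u * v = u' * v')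
    (e₂ : u * Q = u' * Q') (e₃ : P * v = P' * v') (e₄ : P * Q = P' * Q') :
    (u = u' ∧ P = P' ∧ v = v' ∧ Q = Q') ∨ (u = -u' ∧ P = -P' ∧ v = -v' ∧ Q = -Q') := by
  -- The inner product of the two unit vectors turns out to be the common sign ±1.
  obtain ⟨c, hc⟩ : ∃ c, c = v * v' + Q * Q' := ⟨_, rfl⟩
  have a₁ : u = c * u' := by rw [hc]; linear_combination -u * h₁ + v * e₁ + Q * e₂
  have a₂ : P = c * P' := by rw [hc]; linear_combination -P * h₁ + v * e₃ + Q * e₄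
  have a₃ : u' = c * u := by rw [hc]; linear_combination -u' * h₂ - v' * e₁ - Q' * e₂
  have a₄ : P' = c * P := by rw [hc]; linear_combination -P' * h₂ - v' * e₃ - Q' * e₄
  have hc2 : c ^ 2 = 1 := by
    rcases h with h | h
    · apply mul_left_cancel₀ h
      linear_combination -a₁ - c * a₃
    · apply mul_left_cancel₀ h
      linear_combination -a₂ - c * a₄
  have a₅ : (v - c * v') ^ 2 + (Q - c * Q') ^ 2 = 0 := by
    linear_combination h₁ + c ^ 2 * h₂ + 2 * c * hc - hc2
  have a₆ : v = c * v' := by nlinarith [sq_nonneg (v - c * v'), sq_nonneg (Q - c * Q')]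
  have a₇ : Q = c * Q' := by nlinarith [sq_nonneg (v - c * v'), sq_nonneg (Q - c * Q')]
  rcases sq_eq_sq_iff_eq_or_eq_neg.1 (hc2.trans (one_pow 2).symm) with rfl | rfl
  · exact Or.inl ⟨by linear_combination a₁, by linear_combination a₂, by linear_combination a₆,
      by linear_combination a₇⟩
  · exact Or.inr ⟨by linear_combination a₁, by linear_combination a₂, by linear_combination a₆,
      by linear_combination a₇⟩

section

variable {a b m h : ℝ}

theorem param_chi (p : (ℝ × ℝ × ℝ) × (ℝ × ℝ × ℝ)) : param a b m h (chi p) = param a b m h p := by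
  obtain ⟨⟨u₁, Q₁, P₁⟩, ⟨u₂, Q₂, P₂⟩⟩ := p
  simp only [param, chi, chi1, chi2, Prod.map_apply]
  have : a - b * -u₁ * -u₂ = a - b * u₁ * u₂ := by ring
  rw [this, point_inj]
  refine ⟨?_, ?_, ?_, ?_, ?_, ?_, ?_, ?_, ?_⟩ <;> ring

/-- After D is recovered, z₁ gives Q₁ and ω₁ gives P₂, while D, β₃, ω₂, ω₃ give the four products of
(u₁, P₁) with (u₂, Q₂). The first vector is nonzero because u₁ = P₁ = 0 would force a²m = 0. -/
theorem eq_or_eq_chi_of_param_eq (hb : 0 < b) (hab : b < a) (hL : (m, h) ∈ L0 a b)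
    {p q : (ℝ × ℝ × ℝ) × (ℝ × ℝ × ℝ)} (hp : p ∈ Gamma1 a b 0 m h ×ˢ Gamma2 a b 0 m h)
    (hq : q ∈ Gamma1 a b 0 m h ×ˢ Gamma2 a b 0 m h)
    (e : param a b m h p = param a b m h q) : p = q ∨ p = chi q := by
  -- The identity |X|² + |z|² + r² = 2ar²/D makes the denominator D a function of the phase point.
  have hX : ∀ u₁ Q₁ P₁ u₂ Q₂ P₂ : ℝ,
      ((u₁, Q₁, P₁), (u₂, Q₂, P₂)) ∈ Gamma1 a b 0 m h ×ˢ Gamma2 a b 0 m h →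
      (-2 * (a ^ 2 - b ^ 2) * u₁ * (m * a * b * u₂ - hStar a b m h * u₁)
          * (a - b * u₁ * u₂)⁻¹ ^ 2) ^ 2
        + (-2 * (a ^ 2 - b ^ 2) * u₁ * (P₁ * P₂) * (a - b * u₁ * u₂)⁻¹ ^ 2) ^ 2
        + (√(a ^ 2 - b ^ 2) * a * Q₁ * (a - b * u₁ * u₂)⁻¹) ^ 2
        + (√(a ^ 2 - b ^ 2) * b * Q₂ * u₁ * (a - b * u₁ * u₂)⁻¹) ^ 2 + (a ^ 2 - b ^ 2) =
      2 * a * (a ^ 2 - b ^ 2) * (a - b * u₁ * u₂)⁻¹ := by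
    rintro u₁ Q₁ P₁ u₂ Q₂ P₂ ⟨⟨hQ₁, hP₁⟩, ⟨hQ₂, hP₂⟩⟩
    have hk := four_mul_hStar hL
    have hr : √(a ^ 2 - b ^ 2) ^ 2 = a ^ 2 - b ^ 2 := Real.sq_sqrt (sq_sub_sq_pos hb hab).le
    have hD := denominator_pos hb hab hQ₁ hQ₂
    have hi : (a - b * u₁ * u₂) * (a - b * u₁ * u₂)⁻¹ = 1 := mul_inv_cancel₀ hD.ne'
    set r := √(a ^ 2 - b ^ 2)
    set k := hStar a b m h
    set i := (a - b * u₁ * u₂)⁻¹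
    have hi2 : (a - b * u₁ * u₂) ^ 2 * i ^ 2 = 1 := by rw [← mul_pow, hi, one_pow]
    have hE : ((m * a * b * u₂ - k * u₁) ^ 2 + (P₁ * P₂) ^ 2) * i ^ 2 = 1 / 4 := by
      have : (m * a * b * u₂ - k * u₁) ^ 2 + (P₁ * P₂) ^ 2 = (a - b * u₁ * u₂) ^ 2 / 4 := by
        linear_combination P₂ ^ 2 * hP₁ + (k * u₁ ^ 2 - a ^ 2 * m) * hP₂
          + (a - b * u₁ * u₂) ^ 2 / 4 * hk
      rw [this]
      linear_combination hi2 / 4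
    linear_combination 4 * (a ^ 2 - b ^ 2) ^ 2 * u₁ ^ 2 * i ^ 2 * hE
      + i ^ 2 * (a ^ 2 * Q₁ ^ 2 + b ^ 2 * Q₂ ^ 2 * u₁ ^ 2) * hr
      + (a ^ 2 - b ^ 2) * i ^ 2 * (a ^ 2 * hQ₁ + b ^ 2 * u₁ ^ 2 * hQ₂)
      - (a ^ 2 - b ^ 2) * hi2 + 2 * a * (a ^ 2 - b ^ 2) * i * hi
  obtain ⟨⟨u₁, Q₁, P₁⟩, ⟨u₂, Q₂, P₂⟩⟩ := p
  obtain ⟨⟨v₁, R₁, S₁⟩, ⟨v₂, R₂, S₂⟩⟩ := q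
  have fp := hX _ _ _ _ _ _ hp
  have fq := hX _ _ _ _ _ _ hq
  obtain ⟨⟨hQ₁, hP₁⟩, ⟨hQ₂, -⟩⟩ := hp
  obtain ⟨⟨hR₁, -⟩, ⟨hR₂, -⟩⟩ := hq
  have ha : 0 < a := hb.trans hab
  have hr2 := sq_sub_sq_pos hb hab
  have hr : √(a ^ 2 - b ^ 2) ≠ 0 := (Real.sqrt_pos.2 hr2).ne'
  have hm : m ≠ 0 := hL.2.ne
  have hD := denominator_pos hb hab hQ₁ hQ₂
  simp only [param] at e
  obtain ⟨o₁, o₂, o₃, X₁, X₂, -, -, z₁, z₂⟩ := point_inj.1 e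
  rw [X₁, X₂, z₁, z₂, fq] at fp
  have hD' := inv_inj.1 (mul_left_cancel₀ (mul_ne_zero (mul_ne_zero two_ne_zero ha.ne') hr2.ne') fp)
  rw [hD'] at o₁ o₂ o₃ z₁ z₂
  have hi := inv_ne_zero hD.ne'
  generalize (a - b * u₁ * u₂)⁻¹ = i at *
  have eQ₁ : Q₁ = R₁ := by simpa [ha.ne', hr, hi] using z₁
  have eP₂ : P₂ = S₂ := by simpa [ha.ne', hr, hi, hm] using o₁
  subst eQ₁ eP₂
  have t₁ : u₁ * u₂ = v₁ * v₂ := by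
    apply mul_left_cancel₀ hb.ne'
    linear_combination hD'
  have t₂ : u₁ * Q₂ = v₁ * R₂ := by
    apply mul_left_cancel₀ (mul_ne_zero (mul_ne_zero hr hb.ne') hi)
    linear_combination z₂
  have t₃ : P₁ * u₂ = S₁ * v₂ := by
    apply mul_left_cancel₀ (mul_ne_zero (mul_ne_zero (mul_ne_zero hr hm) hb.ne') hi)
    linear_combination -o₂ / 2
  have t₄ : P₁ * Q₂ = S₁ * R₂ := by
    apply mul_left_cancel₀ (mul_ne_zero hb.ne' hi)
    linear_combination -o₃ / 2
  have h0 : u₁ ≠ 0 ∨ P₁ ≠ 0 := by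
    by_contra! hc
    obtain ⟨rfl, rfl⟩ := hc
    apply mul_ne_zero (pow_ne_zero 2 ha.ne') hm
    linear_combination hP₁
  rcases eq_or_eq_neg_of_tensor_eq h0 hQ₂ hR₂ t₁ t₂ t₃ t₄ with
    ⟨rfl, rfl, rfl, rfl⟩ | ⟨rfl, rfl, rfl, rfl⟩
  · exact Or.inl rfl
  · exact Or.inr rfl

/-! ### Surjectivity of the parametrization -/

/-- For X ≠ 0 the equation z² + XȲ = r² determines Y, so a preimage need only match the other seven
coordinates. -/
theorem point_eq_of_regular (hab : a ^ 2 - b ^ 2 ≠ 0) (hL : (m, h) ∈ L0 a b)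
    {o₁ o₂ o₃ X₁ X₂ Y₁ Y₂ Y₁' Y₂' z₁ z₂ : ℝ} (hρ : X₁ ^ 2 + X₂ ^ 2 ≠ 0)
    (hx : point o₁ o₂ o₃ X₁ X₂ Y₁ Y₂ z₁ z₂ ∈ integralManifold a b m h)
    (hx' : point o₁ o₂ o₃ X₁ X₂ Y₁' Y₂' z₁ z₂ ∈ integralManifold a b m h) :
    point o₁ o₂ o₃ X₁ X₂ Y₁ Y₂ z₁ z₂ = point o₁ o₂ o₃ X₁ X₂ Y₁' Y₂' z₁ z₂ := by
  obtain ⟨h₁, h₂, -⟩ := point_mem_phaseSpace.1 ((mem_integralManifold_regular hab hL hρ).1 hx).1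
  obtain ⟨k₁, k₂, -⟩ := point_mem_phaseSpace.1 ((mem_integralManifold_regular hab hL hρ).1 hx').1
  rw [point_inj]
  refine ⟨rfl, rfl, rfl, rfl, rfl, ?_, ?_, rfl, rfl⟩
  · apply mul_left_cancel₀ hρ
    linear_combination X₁ * (h₁ - k₁) + X₂ * (h₂ - k₂)
  · apply mul_left_cancel₀ hρ
    linear_combination X₂ * (h₁ - k₁) - X₁ * (h₂ - k₂)

theorem exists_param_eq_of_regular (hb : 0 < b) (hab : b < a) (hL : (m, h) ∈ L0 a b)
    {o₁ o₂ o₃ X₁ X₂ Y₁ Y₂ z₁ z₂ : ℝ} (hρ : X₁ ^ 2 + X₂ ^ 2 ≠ 0)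
    (hx : point o₁ o₂ o₃ X₁ X₂ Y₁ Y₂ z₁ z₂ ∈ integralManifold a b m h) :
    ∃ p ∈ Gamma1 a b 0 m h ×ˢ Gamma2 a b 0 m h,
      param a b m h p = point o₁ o₂ o₃ X₁ X₂ Y₁ Y₂ z₁ z₂ := by
  have hr2 := sq_sub_sq_pos hb hab
  obtain ⟨hP, ⟨e₁, e₂, e₃⟩, hl⟩ := (mem_integralManifold_regular hr2.ne' hL hρ).1 hx
  obtain ⟨h₁, h₂, h₃⟩ := point_mem_phaseSpace.1 hP
  have ha : 0 < a := hb.trans hab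
  have hm : m ≠ 0 := hL.2.ne
  have hk : hStar a b m h = 1 / (4 * m) := by
    have := four_mul_hStar hL
    field_simp
    linear_combination this
  obtain ⟨r, hrdef⟩ : ∃ r, √(a ^ 2 - b ^ 2) = r := ⟨_, rfl⟩
  have hr : r ^ 2 = a ^ 2 - b ^ 2 := hrdef ▸ Real.sq_sqrt hr2.le
  have hr0 : r ≠ 0 := hrdef ▸ (Real.sqrt_pos.2 hr2).ne'
  have hρ0 : 0 < X₁ ^ 2 + X₂ ^ 2 := lt_of_le_of_ne (by positivity) hρ.symm
  obtain ⟨s, hs0, hs⟩ : ∃ s, s ≠ 0 ∧ X₁ ^ 2 + X₂ ^ 2 = s ^ 2 :=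
    ⟨_, (Real.sqrt_pos.2 hρ0).ne', (Real.sq_sqrt hρ0.le).symm⟩
  -- This is 2ar²/D. Together with s = |X|, which fixes the sign of u₁, and g = w X̄ it inverts the
  -- parametrization.
  obtain ⟨n, hn⟩ : ∃ n, n = X₁ ^ 2 + X₂ ^ 2 + z₁ ^ 2 + z₂ ^ 2 + (a ^ 2 - b ^ 2) := ⟨_, rfl⟩
  have hn0 : n ≠ 0 := by rw [hn]; positivity
  obtain ⟨g₁, hg₁⟩ : ∃ g₁, g₁ = o₁ * X₁ + o₂ * X₂ := ⟨_, rfl⟩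
  obtain ⟨g₂, hg₂⟩ : ∃ g₂, g₂ = o₂ * X₁ - o₁ * X₂ := ⟨_, rfl⟩
  rw [← hg₁, ← hg₂, hs] at e₁ e₂
  rw [← hg₁, ← hg₂, hs] at e₃
  have hg : g₁ ^ 2 + g₂ ^ 2 = -m * s ^ 2 * (n - r ^ 2) := by
    rw [hg₁, hg₂, hn, ← hs, hr]
    linear_combination (X₁ ^ 2 + X₂ ^ 2) * hl
  rw [← hr] at e₂
  have fX : s ^ 2 * X₁ = s ^ 2 * m * n + 2 * g₂ ^ 2 := by
    linear_combination e₂ - hg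
  have w₁ : s ^ 2 * o₁ = m * n * g₁ := by
    have : s ^ 2 * o₁ = g₁ * X₁ - g₂ * X₂ := by rw [hg₁, hg₂, ← hs]; ring
    apply mul_left_cancel₀ (pow_ne_zero 2 hs0)
    linear_combination s ^ 2 * this + g₁ * fX + g₂ * e₃
  have w₂ : s ^ 2 * o₂ = -m * (n - 2 * r ^ 2) * g₂ := by
    have : s ^ 2 * o₂ = g₁ * X₂ + g₂ * X₁ := by rw [hg₁, hg₂, ← hs]; ring
    apply mul_left_cancel₀ (pow_ne_zero 2 hs0)
    linear_combination s ^ 2 * this + g₂ * fX - g₁ * e₃ + 2 * g₂ * hg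
  -- Eliminate Y from the Casimir equations by |X|²|Y|² = |r² − z²|². After division by n² this is
  -- Q₁² + u₁² = 1; the next three identities play the same role for the other curve equations.
  have fQ₁ : n ^ 2 = 4 * a ^ 2 * s ^ 2 + 4 * r ^ 2 * z₁ ^ 2 := by
    rw [hn, ← hs, hr]
    linear_combination (X₁ ^ 2 + X₂ ^ 2) * h₃
      - (a ^ 2 - b ^ 2 - (z₁ ^ 2 - z₂ ^ 2) + (X₁ * Y₁ + X₂ * Y₂)) * h₁
      + (2 * z₁ * z₂ + (X₁ * Y₂ - X₂ * Y₁)) * h₂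
  rw [hs, ← hr] at hn
  have fQ₂ : (n - 2 * r ^ 2) ^ 2 = 4 * b ^ 2 * s ^ 2 - 4 * r ^ 2 * z₂ ^ 2 := by
    linear_combination fQ₁ - 4 * r ^ 2 * hn - 4 * s ^ 2 * hr
  have fP₁ : 4 * m * r ^ 2 * g₂ ^ 2 = s ^ 2 * (s ^ 2 - m ^ 2 * n ^ 2) := by
    apply mul_left_cancel₀ (pow_ne_zero 2 hs0)
    linear_combination s ^ 4 * hs - (s ^ 2 * X₁ + s ^ 2 * m * n + 2 * g₂ ^ 2) * fX
      + (s ^ 2 * X₂ + 2 * g₁ * g₂) * e₃ - 4 * g₂ ^ 2 * hg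
  have fP₂ : -4 * m * r ^ 2 * g₁ ^ 2 = s ^ 2 * (s ^ 2 - m ^ 2 * (n - 2 * r ^ 2) ^ 2) := by
    linear_combination -4 * m * r ^ 2 * hg + fP₁
  have hp : ((2 * a * s / n, 2 * r * z₁ / n, 2 * a * r * g₂ / (s * n)),
      ((n - 2 * r ^ 2) / (2 * b * s), z₂ * r / (s * b), -r * g₁ / s ^ 2)) ∈
      Gamma1 a b 0 m h ×ˢ Gamma2 a b 0 m h := by
    refine ⟨⟨?_, ?_⟩, ⟨?_, ?_⟩⟩
    · field_simp
      linear_combination -fQ₁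
    · rw [hk]
      field_simp
      linear_combination 4 * fP₁
    · field_simp
      linear_combination fQ₂
    · rw [hk]
      field_simp
      linear_combination -4 * fP₂
  refine ⟨_, hp, ?_⟩
  have hD : (a - b * (2 * a * s / n) * ((n - 2 * r ^ 2) / (2 * b * s)))⁻¹ =
      n / (2 * a * r ^ 2) := by
    rw [inv_eq_iff_eq_inv, inv_div]
    field_simp
    ring
  have hx' := param_mem hb hab hL hp
  simp only [param] at hx' ⊢
  rw [hD, hrdef, ← hr, hk] at hx' ⊢
  have E₁ : -2 * r * m * a * (-r * g₁ / s ^ 2) * (n / (2 * a * r ^ 2)) = o₁ := by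
    field_simp
    linear_combination -w₁
  have E₂ : -2 * r * m * b * ((n - 2 * r ^ 2) / (2 * b * s))
      * (2 * a * r * g₂ / (s * n)) * (n / (2 * a * r ^ 2)) = o₂ := by
    field_simp
    linear_combination -w₂
  have E₃ : -2 * (a * (2 * r * z₁ / n) * (-r * g₁ / s ^ 2)
      + b * (z₂ * r / (s * b)) * (2 * a * r * g₂ / (s * n))) * (n / (2 * a * r ^ 2)) = o₃ := by
    field_simp
    linear_combination -e₁
  have E₄ : -2 * r ^ 2 * (2 * a * s / n) * (m * a * b *
      ((n - 2 * r ^ 2) / (2 * b * s)) - 1 / (4 * m) * (2 * a * s / n))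
      * (n / (2 * a * r ^ 2)) ^ 2 = X₁ := by
    field_simp
    apply mul_left_cancel₀ (pow_ne_zero 2 hs0)
    linear_combination -8 * m * r ^ 2 * fX - 4 * fP₁
  have E₅ : -2 * r ^ 2 * (2 * a * s / n) * ((2 * a * r * g₂ / (s * n)) * (-r * g₁ / s ^ 2))
      * (n / (2 * a * r ^ 2)) ^ 2 = X₂ := by
    field_simp
    linear_combination e₃
  have E₆ : r * a * (2 * r * z₁ / n) * (n / (2 * a * r ^ 2)) = z₁ := by
    field_simp
  have E₇ : r * b * (z₂ * r / (s * b)) * (2 * a * s / n) * (n / (2 * a * r ^ 2)) = z₂ := by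
    field_simp
  rw [E₁, E₂, E₃, E₄, E₅, E₆, E₇] at hx' ⊢
  exact point_eq_of_regular hr2.ne' hL hρ hx' hx

/-- The number (1 − mY)w̄ has real part m z₁ω₃ by `crit`. The energy equation and the equation of L₀
give it the modulus |m z₁ω₃|, so its imaginary part is zero. -/
theorem SingularEqs.parallel (hL : (m, h) ∈ L0 a b)
    {o₁ o₂ o₃ Y₁ Y₂ z₁ z₂ : ℝ} (e : SingularEqs a b m h o₁ o₂ o₃ Y₁ Y₂ z₁ z₂) :
    m * Y₂ * o₁ = (m * Y₁ - 1) * o₂ := by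
  obtain ⟨-, hz, hY, hw, hc, hH⟩ := e
  obtain ⟨hl, hm⟩ := hL
  simp only at hl hm
  rw [← sub_eq_zero, ← sq_eq_zero_iff]
  linear_combination -((m * Y₁ - 1) * o₁ + m * Y₂ * o₂ - m * z₁ * o₃) * hc
    + m ^ 2 * (o₁ ^ 2 + o₂ ^ 2) * hY + (4 * b ^ 2 * m ^ 2 - 2 * m * Y₁ + 1) * hw
    - m ^ 2 * o₃ ^ 2 * hz - 2 * m ^ 2 * (a ^ 2 - b ^ 2) * (hH - hw) - m * (a ^ 2 - b ^ 2) * hl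

/-- Here the energy gives Y₁. The equation m z₁ω₃ = (1 − mY)w̄, with w ≠ 0, then gives Y₂. -/
theorem point_eq_of_singular (hab : 0 < a ^ 2 - b ^ 2) (hL : (m, h) ∈ L0 a b)
    {o₁ o₂ o₃ Y₁ Y₂ Y₁' Y₂' z₁ z₂ : ℝ}
    (hx : point o₁ o₂ o₃ 0 0 Y₁ Y₂ z₁ z₂ ∈ integralManifold a b m h)
    (hx' : point o₁ o₂ o₃ 0 0 Y₁' Y₂' z₁ z₂ ∈ integralManifold a b m h) :
    point o₁ o₂ o₃ 0 0 Y₁ Y₂ z₁ z₂ = point o₁ o₂ o₃ 0 0 Y₁' Y₂' z₁ z₂ := by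
  have e := (mem_integralManifold_singular hab hL.2).1 hx
  have e' := (mem_integralManifold_singular hab hL.2).1 hx'
  have hY : Y₁ = Y₁' := by linear_combination e'.energy - e.energy
  subst hY
  have hm : m ≠ 0 := hL.2.ne
  rw [point_inj]
  refine ⟨rfl, rfl, rfl, rfl, rfl, rfl, ?_, rfl, rfl⟩
  have hw : m * (o₁ ^ 2 + o₂ ^ 2) ≠ 0 := by
    rw [e.normSq_ω]
    exact mul_ne_zero hm (mul_ne_zero (neg_ne_zero.2 hm) hab.ne')
  apply mul_left_cancel₀ hw
  linear_combination o₁ * (e.parallel hL) - o₁ * (e'.parallel hL)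
    + o₂ * e.crit - o₂ * e'.crit

theorem exists_param_eq_of_singular (hb : 0 < b) (hab : b < a) (hL : (m, h) ∈ L0 a b)
    {o₁ o₂ o₃ Y₁ Y₂ z₁ z₂ : ℝ}
    (hx : point o₁ o₂ o₃ 0 0 Y₁ Y₂ z₁ z₂ ∈ integralManifold a b m h) :
    ∃ p ∈ Gamma1 a b 0 m h ×ˢ Gamma2 a b 0 m h,
      param a b m h p = point o₁ o₂ o₃ 0 0 Y₁ Y₂ z₁ z₂ := by
  have hr2 := sq_sub_sq_pos hb hab
  have e := (mem_integralManifold_singular hr2 hL.2).1 hx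
  have hpar := e.parallel hL
  obtain ⟨rfl, hz, hY, hw, hc, hH⟩ := e
  have ha : 0 < a := hb.trans hab
  have hm : m ≠ 0 := hL.2.ne
  have hl := hL.1
  simp only at hl
  have hk : hStar a b m h = 1 / (4 * m) := by
    have := four_mul_hStar hL
    field_simp
    linear_combination this
  obtain ⟨r, hrdef⟩ : ∃ r, √(a ^ 2 - b ^ 2) = r := ⟨_, rfl⟩
  have hr : r ^ 2 = a ^ 2 - b ^ 2 := hrdef ▸ Real.sq_sqrt hr2.le
  have hr0 : r ≠ 0 := hrdef ▸ (Real.sqrt_pos.2 hr2).ne'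
  obtain ⟨t, ht0, ht⟩ : ∃ t, t ≠ 0 ∧ -m = t ^ 2 :=
    ⟨_, (Real.sqrt_pos.2 (neg_pos.2 hL.2)).ne', (Real.sq_sqrt (neg_pos.2 hL.2).le).symm⟩
  obtain rfl : m = -t ^ 2 := by linear_combination -ht
  rw [← hr] at hz hw
  -- X = 0 forces u₁ = 0 and P₁² = −a²m = (at)²; the root P₁ = −at would give the χ-image.
  have hp : ((0, z₁ / r, a * t), (o₂ / (2 * r * b * t ^ 3),
      -(o₃ * r ^ 2 * t ^ 2 + z₁ * o₁) / (2 * r ^ 2 * b * t ^ 3), o₁ / (2 * r * t ^ 2))) ∈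
      Gamma1 a b 0 (-t ^ 2) h ×ˢ Gamma2 a b 0 (-t ^ 2) h := by
    refine ⟨⟨?_, ?_⟩, ⟨?_, ?_⟩⟩
    · field_simp
      linear_combination hz
    · ring
    · field_simp
      linear_combination o₁ ^ 2 * hz + r ^ 2 * hw + 2 * r ^ 4 * t ^ 4 * (hH - hw)
        - 2 * r ^ 2 * o₁ * hc + 2 * r ^ 2 * o₂ * hpar - 2 * r ^ 2 * (1 + t ^ 2 * Y₁) * hw
        - r ^ 4 * t ^ 2 * hl - 2 * r ^ 4 * t ^ 6 * hr
    · rw [hk]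
      field_simp
      linear_combination 4 * hw
  refine ⟨_, hp, ?_⟩
  have hx' := param_mem hb hab hL hp
  simp only [param] at hx' ⊢
  rw [hrdef, mul_zero, zero_mul, sub_zero] at hx' ⊢
  have E₁ : -2 * r * -t ^ 2 * a * (o₁ / (2 * r * t ^ 2)) * a⁻¹ = o₁ := by
    field_simp
  have E₂ : -2 * r * -t ^ 2 * b * (o₂ / (2 * r * b * t ^ 3)) * (a * t) * a⁻¹ = o₂ := by
    field_simp
  have E₃ : -2 * (a * (z₁ / r) * (o₁ / (2 * r * t ^ 2))
      + b * (-(o₃ * r ^ 2 * t ^ 2 + z₁ * o₁) / (2 * r ^ 2 * b * t ^ 3)) * (a * t)) * a⁻¹ = o₃ := by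
    field_simp
    ring
  have E₄ : r * a * (z₁ / r) * a⁻¹ = z₁ := by
    field_simp
  have E₅ : ∀ c d : ℝ, -2 * (a ^ 2 - b ^ 2) * 0 * c * d = 0 := fun c d => by ring
  have E₆ : ∀ c d : ℝ, c * 0 * d = 0 := fun c d => by ring
  rw [E₁, E₂, E₃, E₄, E₅, E₅, E₆ _ a⁻¹] at hx' ⊢
  exact point_eq_of_singular hr2 hL hx' hx

theorem exists_param_eq (hb : 0 < b) (hab : b < a) (hL : (m, h) ∈ L0 a b) {x : Ambient}
    (hx : x ∈ integralManifold a b m h) :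
    ∃ p ∈ Gamma1 a b 0 m h ×ˢ Gamma2 a b 0 m h, param a b m h p = x := by
  obtain ⟨o₁, o₂, o₃, X₁, X₂, Y₁, Y₂, z₁, z₂, rfl⟩ := exists_point x
  by_cases hρ : X₁ ^ 2 + X₂ ^ 2 = 0
  · obtain rfl : X₁ = 0 := by nlinarith [sq_nonneg X₁, sq_nonneg X₂]
    obtain rfl : X₂ = 0 := by nlinarith [sq_nonneg X₂]
    exact exists_param_eq_of_singular hb hab hL hx
  · exact exists_param_eq_of_regular hb hab hL hρ hx

end

/-! ### Signs, the circle, compactness and quotient maps -/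

theorem continuous_ite_pos {X Y : Type*} [TopologicalSpace X] [TopologicalSpace Y] {f : X → ℝ}
    (hf : Continuous f) (h0 : ∀ x, f x ≠ 0) (y y' : Y) :
    Continuous fun x => if 0 < f x then y else y' := by
  have hc : IsClopen {x | 0 < f x} := by
    refine ⟨?_, isOpen_lt continuous_const hf⟩
    have : {x | 0 < f x} = {x | 0 ≤ f x} :=
      Set.ext fun x => by
        simpa only [Set.mem_ofPred_eq] using ⟨le_of_lt, fun h => lt_of_le_of_ne h (h0 x).symm⟩
    rw [this]
    exact isClosed_le continuous_const hf
  refine Continuous.if ?_ continuous_const continuous_const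
  intro x hx
  rw [hc.frontier_eq] at hx
  exact hx.elim

theorem eq_of_sq_eq_of_pos_iff {x y : ℝ} (h : x ^ 2 = y ^ 2) (h0 : x ≠ 0) (hs : 0 < x ↔ 0 < y) :
    x = y := by
  rcases sq_eq_sq_iff_eq_or_eq_neg.1 h with h | h
  · exact h
  · rcases lt_or_gt_of_ne h0 with hx | hx
    · have : ¬ 0 < y := fun hy => hx.not_gt (hs.2 hy)
      linarith
    · have := hs.1 hx
      linarith

/-- The side of `0` on which a real number lies. -/
def side (x : ℝ) : Fin 2 := if 0 < x then 1 else 0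

theorem side_eq_iff {x y : ℝ} : side x = side y ↔ (0 < x ↔ 0 < y) := by
  unfold side
  by_cases hx : 0 < x <;> by_cases hy : 0 < y <;> simp [hx, hy]

theorem exists_sq_eq_side_eq {c : ℝ} (hc : 0 < c) (i : Fin 2) : ∃ x, x ^ 2 = c ∧ side x = i := by
  have h := Real.sqrt_pos.2 hc
  fin_cases i
  · exact ⟨-√c, by rw [neg_sq, Real.sq_sqrt hc.le], if_neg (by linarith)⟩
  · exact ⟨√c, Real.sq_sqrt hc.le, if_pos h⟩

/-- The sign of a nonzero real number, as a real number. -/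
def sgn (x : ℝ) : ℝ := if 0 < x then 1 else -1

theorem sgn_sq (x : ℝ) : sgn x ^ 2 = 1 := by
  unfold sgn
  split_ifs <;> norm_num

/-- The point of the circle with given Cartesian coordinates. -/
def toCircle (x y : ℝ) (h : x ^ 2 + y ^ 2 = 1) : Circle :=
  ⟨⟨x, y⟩, by
    refine mem_sphere_zero_iff_norm.2 ?_
    rw [Complex.norm_def, Complex.normSq_mk, ← sq, ← sq, h, Real.sqrt_one]⟩

theorem toCircle_inj {x y x' y' : ℝ} {h : x ^ 2 + y ^ 2 = 1} {h' : x' ^ 2 + y' ^ 2 = 1} :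
    toCircle x y h = toCircle x' y' h' ↔ x = x' ∧ y = y' := by
  rw [Circle.ext_iff]
  change (⟨x, y⟩ : ℂ) = ⟨x', y'⟩ ↔ _
  rw [Complex.mk.injEq]

theorem exists_toCircle (z : Circle) : ∃ x y h, z = toCircle x y h := by
  refine ⟨(z : ℂ).re, (z : ℂ).im, ?_, rfl⟩
  have := Circle.normSq_coe z
  rw [Complex.normSq_apply] at this
  linear_combination this

theorem continuous_toCircle {X : Type*} [TopologicalSpace X] {f g : X → ℝ} (hf : Continuous f)
    (hg : Continuous g) (h : ∀ x, f x ^ 2 + g x ^ 2 = 1) :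
    Continuous fun x => toCircle (f x) (g x) (h x) := by
  refine Continuous.subtype_mk ?_ _
  exact Complex.equivRealProdCLM.symm.continuous.comp (hf.prodMk hg)

theorem isCompact_curve (A B C : ℝ) :
    IsCompact {(u, Q, P) : ℝ × ℝ × ℝ | Q ^ 2 + u ^ 2 = 1 ∧ P ^ 2 = A * u ^ 2 + B * u + C} := by
  have hK : IsCompact (Set.Icc (-1 : ℝ) 1 ×ˢ (Set.Icc (-1 : ℝ) 1 ×ˢ
      Set.Icc (-(1 + |A| + |B| + |C|)) (1 + |A| + |B| + |C|))) :=
    isCompact_Icc.prod (isCompact_Icc.prod isCompact_Icc)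
  refine hK.of_isClosed_subset ?_ ?_
  · refine IsClosed.inter (isClosed_eq ?_ ?_) (isClosed_eq ?_ ?_) <;> fun_prop
  · rintro ⟨u, Q, P⟩ ⟨h₁, h₂⟩
    have hu : |u| ≤ 1 := abs_le_one_iff_mul_self_le_one.2 (by nlinarith [sq_nonneg Q])
    have hQ : |Q| ≤ 1 := abs_le_one_iff_mul_self_le_one.2 (by nlinarith [sq_nonneg u])
    refine ⟨abs_le.1 hu, abs_le.1 hQ, abs_le.1 ?_⟩
    have hA : A * u ^ 2 ≤ |A| := by
      nlinarith [le_abs_self A, abs_nonneg A, sq_nonneg u, sq_nonneg Q]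
    have hB : B * u ≤ |B| := (le_abs_self _).trans (by
      rw [abs_mul]
      exact mul_le_of_le_one_right (abs_nonneg B) hu)
    have hC := le_abs_self C
    have h₃ : |P| ^ 2 ≤ |A| + |B| + |C| := by
      rw [sq_abs, h₂]
      linarith
    nlinarith [abs_nonneg P, abs_nonneg A, abs_nonneg B, abs_nonneg C]

theorem nonempty_homeomorph_of_bijective {X Y : Type*} [TopologicalSpace X] [CompactSpace X]
    [TopologicalSpace Y] [T2Space Y] {f : X → Y} (hf : Continuous f) (hb : Function.Bijective f) :
    Nonempty (X ≃ₜ Y) :=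
  ⟨Continuous.homeoOfEquivCompactToT2 (f := Equiv.ofBijective f hb) hf⟩

section

variable {a b m h : ℝ}

theorem isCompact_Gamma1 (l : ℝ) : IsCompact (Gamma1 a b l m h) := by
  convert isCompact_curve (hStar a b m h) (a * l) (-(a ^ 2 * m)) using 1
  ext ⟨u, Q, P⟩
  simp only [Gamma1, Set.mem_ofPred_eq]
  exact and_congr_right fun _ => ⟨fun h => by linear_combination h, fun h => by linear_combination h⟩

theorem isCompact_Gamma2 (l : ℝ) : IsCompact (Gamma2 a b l m h) := by
  convert isCompact_curve (b ^ 2 * m) (-(b * l)) (-hStar a b m h) using 1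
  ext ⟨u, Q, P⟩
  simp only [Gamma2, Set.mem_ofPred_eq]
  exact and_congr_right fun _ => ⟨fun h => by linear_combination h, fun h => by linear_combination h⟩

/-- Γ₁ × Γ₂ is compact, so the induced continuous bijection onto a Hausdorff space is a
homeomorphism. This serves both for the integral manifold and for the explicit models. -/
theorem nonempty_homeomorph_gammaQuotient {Y : Type*} [TopologicalSpace Y] [T2Space Y]
    {f : ↥(Gamma1 a b 0 m h ×ˢ Gamma2 a b 0 m h) → Y} (hf : Continuous f)
    (hsurj : Function.Surjective f)
    (hfib : ∀ x y, f x = f y ↔ x.1 = y.1 ∨ x.1 = chi y.1) :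
    Nonempty (GammaQuotient a b m h ≃ₜ Y) := by
  have : CompactSpace ↥(Gamma1 a b 0 m h ×ˢ Gamma2 a b 0 m h) :=
    isCompact_iff_compactSpace.1 ((isCompact_Gamma1 0).prod (isCompact_Gamma2 0))
  refine nonempty_homeomorph_of_bijective (f := Quotient.lift f fun x y e => (hfib x y).2 e)
    (hf.quotient_lift _) ⟨?_, ?_⟩
  · rintro ⟨x⟩ ⟨y⟩ e
    exact Quotient.sound ((hfib x y).1 e)
  · intro y
    obtain ⟨x, rfl⟩ := hsurj y
    exact ⟨⟦x⟧, rfl⟩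

theorem continuousOn_param (hb : 0 < b) (hab : b < a) :
    ContinuousOn (param a b m h) (Gamma1 a b 0 m h ×ˢ Gamma2 a b 0 m h) := by
  have hi : ContinuousOn (fun p : (ℝ × ℝ × ℝ) × (ℝ × ℝ × ℝ) => (a - b * p.1.1 * p.2.1)⁻¹)
      (Gamma1 a b 0 m h ×ˢ Gamma2 a b 0 m h) := by
    refine ContinuousOn.inv₀ (by fun_prop) ?_
    rintro ⟨⟨u₁, Q₁, P₁⟩, ⟨u₂, Q₂, P₂⟩⟩ ⟨⟨hQ₁, -⟩, ⟨hQ₂, -⟩⟩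
    exact (denominator_pos hb hab hQ₁ hQ₂).ne'
  unfold param point
  refine ContinuousOn.prodMk ?_ (ContinuousOn.prodMk ?_ ?_) <;>
    refine continuousOn_pi.2 fun j => ?_ <;> fin_cases j <;> simp [-inv_pow] <;>
    fun_prop

theorem nonempty_homeomorph_integralManifold (hb : 0 < b) (hab : b < a) (hL : (m, h) ∈ L0 a b) :
    Nonempty (integralManifold a b m h ≃ₜ GammaQuotient a b m h) := by
  have hc := continuousOn_iff_continuous_domRestrict.1 (continuousOn_param (m := m) (h := h) hb hab)
  suffices h : Nonempty (GammaQuotient a b m h ≃ₜ integralManifold a b m h) from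
    h.map Homeomorph.symm
  refine nonempty_homeomorph_gammaQuotient
    (f := fun p => (⟨param a b m h p.1, param_mem hb hab hL p.2⟩ : integralManifold a b m h))
    (hc.subtype_mk _) ?_ ?_
  · rintro ⟨x, hx⟩
    obtain ⟨p, hp, rfl⟩ := exists_param_eq hb hab hL hx
    exact ⟨⟨p, hp⟩, rfl⟩
  · intro p q
    rw [Subtype.mk.injEq]
    constructor
    · exact eq_or_eq_chi_of_param_eq hb hab hL p.2 q.2
    · rintro (e | e)
      · rw [e]
      · rw [e, param_chi]

end

/-! ### The curves over L₀ and the quotient when 4a²m² > 1 -/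

section

variable {a b m h u Q P : ℝ}

/-- The relation 4m h_* = 1 removes h_*. With m < 0 the equation is an ellipse in (u, P), and
comparing its u-semiaxis 2a|m| with 1 decides which of P, Q cannot vanish. -/
theorem Gamma1.sq_P (hL : (m, h) ∈ L0 a b) (hx : (u, Q, P) ∈ Gamma1 a b 0 m h) :
    4 * m * P ^ 2 = u ^ 2 - 4 * a ^ 2 * m ^ 2 := by
  obtain ⟨-, h₂⟩ := hx
  linear_combination 4 * m * h₂ + u ^ 2 * four_mul_hStar hL

theorem Gamma2.sq_P (hL : (m, h) ∈ L0 a b) (hx : (u, Q, P) ∈ Gamma2 a b 0 m h) :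
    4 * m * P ^ 2 = 4 * b ^ 2 * m ^ 2 * u ^ 2 - 1 := by
  obtain ⟨-, h₂⟩ := hx
  linear_combination 4 * m * h₂ - four_mul_hStar hL

theorem mem_Gamma1 (hL : (m, h) ∈ L0 a b) (h₁ : Q ^ 2 + u ^ 2 = 1)
    (h₂ : 4 * m * P ^ 2 = u ^ 2 - 4 * a ^ 2 * m ^ 2) : (u, Q, P) ∈ Gamma1 a b 0 m h := by
  refine ⟨h₁, ?_⟩
  apply mul_left_cancel₀ (mul_ne_zero four_ne_zero hL.2.ne)
  linear_combination h₂ - u ^ 2 * four_mul_hStar hL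

theorem mem_Gamma2 (hL : (m, h) ∈ L0 a b) (h₁ : Q ^ 2 + u ^ 2 = 1)
    (h₂ : 4 * m * P ^ 2 = 4 * b ^ 2 * m ^ 2 * u ^ 2 - 1) : (u, Q, P) ∈ Gamma2 a b 0 m h := by
  refine ⟨h₁, ?_⟩
  apply mul_left_cancel₀ (mul_ne_zero four_ne_zero hL.2.ne)
  linear_combination h₂ + four_mul_hStar hL

theorem Gamma1.P_ne_zero (hL : (m, h) ∈ L0 a b) (hm : 1 < 4 * a ^ 2 * m ^ 2)
    (hx : (u, Q, P) ∈ Gamma1 a b 0 m h) : P ≠ 0 := by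
  rintro rfl
  nlinarith [Gamma1.sq_P hL hx, hx.1, sq_nonneg Q]

theorem Gamma1.Q_ne_zero (hL : (m, h) ∈ L0 a b) (hm : 4 * a ^ 2 * m ^ 2 < 1)
    (hx : (u, Q, P) ∈ Gamma1 a b 0 m h) : Q ≠ 0 := by
  rintro rfl
  have hm' : m < 0 := hL.2
  nlinarith [Gamma1.sq_P hL hx, hx.1, mul_nonneg (neg_nonneg.2 hm'.le) (sq_nonneg P)]

theorem Gamma2.P_ne_zero (hL : (m, h) ∈ L0 a b) (hm : 4 * b ^ 2 * m ^ 2 < 1)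
    (hx : (u, Q, P) ∈ Gamma2 a b 0 m h) : P ≠ 0 := by
  rintro rfl
  have h₁ := Gamma2.sq_P hL hx
  have h₂ : 4 * b ^ 2 * m ^ 2 * u ^ 2 ≤ 4 * b ^ 2 * m ^ 2 * 1 :=
    mul_le_mul_of_nonneg_left (by nlinarith [hx.1, sq_nonneg Q]) (by positivity)
  linarith

theorem Gamma2.Q_ne_zero (hL : (m, h) ∈ L0 a b) (hm : 1 < 4 * b ^ 2 * m ^ 2)
    (hx : (u, Q, P) ∈ Gamma2 a b 0 m h) : Q ≠ 0 := by
  rintro rfl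
  have hm' : m < 0 := hL.2
  have h₁ := Gamma2.sq_P hL hx
  have h₂ : u ^ 2 = 1 := by linear_combination hx.1
  rw [h₂] at h₁
  nlinarith [mul_nonneg (neg_nonneg.2 hm'.le) (sq_nonneg P)]

theorem sgn_mul_mem_Gamma2 (s : ℝ) (hs : s ^ 2 = 1) (hx : (u, Q, P) ∈ Gamma2 a b 0 m h) :
    (s * u, s * Q, P) ∈ Gamma2 a b 0 m h := by
  obtain ⟨h₁, h₂⟩ := hx
  exact ⟨by linear_combination h₁ + (Q ^ 2 + u ^ 2) * hs,
    by linear_combination h₂ - b ^ 2 * m * u ^ 2 * hs⟩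

/-- If `P₁` does not vanish on `Γ₁`, then every orbit has a unique representative with
`P₁ > 0`. -/
theorem gammaQuotient_homeomorph_of_one_lt (hL : (m, h) ∈ L0 a b) (hm : 1 < 4 * a ^ 2 * m ^ 2) :
    Nonempty (GammaQuotient a b m h ≃ₜ Circle × Gamma2 a b 0 m h) := by
  have hP : ∀ x : ↥(Gamma1 a b 0 m h ×ˢ Gamma2 a b 0 m h), x.1.1.2.2 ≠ 0 :=
    fun x => Gamma1.P_ne_zero hL hm x.2.1
  have hs : Continuous fun x : ↥(Gamma1 a b 0 m h ×ˢ Gamma2 a b 0 m h) => sgn x.1.1.2.2 :=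
    continuous_ite_pos (by fun_prop) hP 1 (-1)
  have hC : ∀ x : ↥(Gamma1 a b 0 m h ×ˢ Gamma2 a b 0 m h),
      (sgn x.1.1.2.2 * x.1.1.1) ^ 2 + x.1.1.2.1 ^ 2 = 1 := fun x => by
    have h₁ : x.1.1.2.1 ^ 2 + x.1.1.1 ^ 2 = 1 := x.2.1.1
    linear_combination h₁ + x.1.1.1 ^ 2 * sgn_sq x.1.1.2.2
  refine nonempty_homeomorph_gammaQuotient (f := fun x =>
    (toCircle (sgn x.1.1.2.2 * x.1.1.1) x.1.1.2.1 (hC x),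
      ⟨(sgn x.1.1.2.2 * x.1.2.1, sgn x.1.1.2.2 * x.1.2.2.1, x.1.2.2.2),
        sgn_mul_mem_Gamma2 _ (sgn_sq _) x.2.2⟩)) ?_ ?_ ?_
  · refine (continuous_toCircle (by fun_prop) (by fun_prop) hC).prodMk (Continuous.subtype_mk ?_ _)
    fun_prop
  · rintro ⟨z, ⟨⟨u₂, Q₂, P₂⟩, hx⟩⟩
    obtain ⟨u, Q, hc, rfl⟩ := exists_toCircle z
    have hm' : m < 0 := hL.2
    -- The final argument `1` selects the positive root, i.e. the representative with P₁ > 0.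
    obtain ⟨P, hP, hPs⟩ := exists_sq_eq_side_eq (c := (u ^ 2 - 4 * a ^ 2 * m ^ 2) / (4 * m))
      (div_pos_of_neg_of_neg (by nlinarith [sq_nonneg Q]) (by linarith)) 1
    have hP' : sgn P = 1 := by
      unfold side at hPs
      unfold sgn
      split_ifs at hPs ⊢
      · rfl
      · simp at hPs
    refine ⟨⟨((u, Q, P), (u₂, Q₂, P₂)), mem_Gamma1 hL (by linear_combination hc) ?_, hx⟩, ?_⟩
    · rw [hP, mul_div_cancel₀ _ (by simp [hm'.ne])]
    · simp [hP']
  · rintro ⟨⟨⟨u₁, Q₁, P₁⟩, ⟨u₂, Q₂, P₂⟩⟩, hx⟩ ⟨⟨⟨v₁, R₁, S₁⟩, ⟨v₂, R₂, S₂⟩⟩, hy⟩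
    have hP₁ : P₁ ≠ 0 := hP ⟨_, hx⟩
    have hS₁ : S₁ ≠ 0 := hP ⟨_, hy⟩
    simp only [Prod.mk.injEq, toCircle_inj, Subtype.mk.injEq, chi, chi1, chi2, Prod.map_apply]
    constructor
    · rintro ⟨⟨e₁, rfl⟩, e₂, e₃, rfl⟩
      have hsq : P₁ ^ 2 = S₁ ^ 2 := by
        have h₁ := Gamma1.sq_P hL hx.1
        have h₂ := Gamma1.sq_P hL hy.1
        have h₃ : u₁ ^ 2 = v₁ ^ 2 := by linear_combination hx.1.1 - hy.1.1
        apply mul_left_cancel₀ (mul_ne_zero four_ne_zero hL.2.ne)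
        linear_combination h₁ - h₂ + h₃
      unfold sgn at e₁ e₂ e₃
      rcases sq_eq_sq_iff_eq_or_eq_neg.1 hsq with rfl | rfl
      · left
        split_ifs at e₁ e₂ e₃ <;> simp_all
      · right
        rcases lt_or_gt_of_ne hS₁ with hS | hS
        · simp only [neg_pos, hS, hS.not_gt, if_true, if_false] at e₁ e₂ e₃
          refine ⟨⟨?_, rfl, rfl⟩, ?_, ?_, rfl⟩ <;> linarith
        · have : ¬ (0 < -S₁) := by linarith
          simp only [this, hS, if_true, if_false] at e₁ e₂ e₃
          refine ⟨⟨?_, rfl, rfl⟩, ?_, ?_, rfl⟩ <;> linarith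
    · rintro (⟨⟨rfl, rfl, rfl⟩, rfl, rfl, rfl⟩ | ⟨⟨rfl, rfl, rfl⟩, rfl, rfl, rfl⟩)
      · simp
      · have : sgn (-S₁) = -sgn S₁ := by
          unfold sgn
          rcases lt_or_gt_of_ne hS₁ with hS | hS
          · rw [if_pos (by linarith), if_neg hS.not_gt, neg_neg]
          · rw [if_neg (by linarith), if_pos hS]
        simp [this]

/-- Q never vanishes, so the curve is two graphs over the ellipse in (u, P), separated by the sign
of Q. -/
theorem gamma2_homeomorph_of_one_lt (hb : 0 < b) (hL : (m, h) ∈ L0 a b)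
    (hm : 1 < 4 * b ^ 2 * m ^ 2) : Nonempty (Gamma2 a b 0 m h ≃ₜ Fin 2 × Circle) := by
  have : CompactSpace (Gamma2 a b 0 m h) := isCompact_iff_compactSpace.1 (isCompact_Gamma2 0)
  have hm' : m < 0 := hL.2
  obtain ⟨t, ht0, ht⟩ : ∃ t, 0 < t ∧ -m = t ^ 2 :=
    ⟨_, Real.sqrt_pos.2 (neg_pos.2 hm'), (Real.sq_sqrt (neg_pos.2 hm').le).symm⟩
  have hm0 : m ≠ 0 := hm'.ne
  have hC : ∀ x : Gamma2 a b 0 m h, (2 * b * m * x.1.1) ^ 2 + (2 * t * x.1.2.2) ^ 2 = 1 := fun x => by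
    have := Gamma2.sq_P hL x.2
    linear_combination -this - 4 * x.1.2.2 ^ 2 * ht
  refine nonempty_homeomorph_of_bijective (f := fun x : Gamma2 a b 0 m h =>
    (side x.1.2.1, toCircle (2 * b * m * x.1.1) (2 * t * x.1.2.2) (hC x))) ?_ ⟨?_, ?_⟩
  · refine (continuous_ite_pos (by fun_prop) (fun x => Gamma2.Q_ne_zero hL hm x.2) _ _).prodMk
      (continuous_toCircle (by fun_prop) (by fun_prop) hC)
  · rintro ⟨⟨u, Q, P⟩, hx⟩ ⟨⟨v, R, S⟩, hy⟩ e
    simp only [Prod.mk.injEq, toCircle_inj, side_eq_iff] at e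
    obtain ⟨e₁, e₂, e₃⟩ := e
    obtain rfl : u = v := mul_left_cancel₀ (by simp [hb.ne', hm'.ne]) e₂
    obtain rfl : P = S := mul_left_cancel₀ (by simp [ht0.ne']) e₃
    obtain rfl : Q = R := eq_of_sq_eq_of_pos_iff (by linear_combination hx.1 - hy.1)
      (Gamma2.Q_ne_zero hL hm hx) e₁
    rfl
  · rintro ⟨i, z⟩
    obtain ⟨x, y, hc, rfl⟩ := exists_toCircle z
    have hbm : 2 * b * m ≠ 0 := by simp [hb.ne', hm'.ne]
    have hu : (x / (2 * b * m)) ^ 2 < 1 := by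
      rw [div_pow, div_lt_one (by positivity)]
      nlinarith [sq_nonneg y]
    obtain ⟨Q, hQ, rfl⟩ := exists_sq_eq_side_eq (sub_pos.2 hu) i
    refine ⟨⟨(x / (2 * b * m), Q, y / (2 * t)), mem_Gamma2 hL (by rw [hQ]; ring) ?_⟩, ?_⟩
    · obtain rfl : m = -t ^ 2 := by linear_combination -ht
      field_simp
      linear_combination -4 * hc
    · simp only [Prod.mk.injEq, toCircle_inj]
      refine ⟨trivial, ?_, ?_⟩ <;> field_simp

/-- Now P never vanishes, and the two components are graphs over the unit circle in (u, Q). -/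
theorem gamma2_homeomorph_of_lt_one (hL : (m, h) ∈ L0 a b)
    (hm : 4 * b ^ 2 * m ^ 2 < 1) : Nonempty (Gamma2 a b 0 m h ≃ₜ Fin 2 × Circle) := by
  have : CompactSpace (Gamma2 a b 0 m h) := isCompact_iff_compactSpace.1 (isCompact_Gamma2 0)
  have hm' : m < 0 := hL.2
  have hC : ∀ x : Gamma2 a b 0 m h, x.1.1 ^ 2 + x.1.2.1 ^ 2 = 1 := fun x => by
    have : x.1.2.1 ^ 2 + x.1.1 ^ 2 = 1 := x.2.1
    linear_combination this
  refine nonempty_homeomorph_of_bijective (f := fun x : Gamma2 a b 0 m h =>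
    (side x.1.2.2, toCircle x.1.1 x.1.2.1 (hC x))) ?_ ⟨?_, ?_⟩
  · refine (continuous_ite_pos (by fun_prop) (fun x => Gamma2.P_ne_zero hL hm x.2) _ _).prodMk
      (continuous_toCircle (by fun_prop) (by fun_prop) hC)
  · rintro ⟨⟨u, Q, P⟩, hx⟩ ⟨⟨v, R, S⟩, hy⟩ e
    simp only [Prod.mk.injEq, toCircle_inj, side_eq_iff] at e
    obtain ⟨e₁, rfl, rfl⟩ := e
    obtain rfl : P = S := eq_of_sq_eq_of_pos_iff (hx.2.trans hy.2.symm)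
      (Gamma2.P_ne_zero hL hm hx) e₁
    rfl
  · rintro ⟨i, z⟩
    obtain ⟨x, y, hc, rfl⟩ := exists_toCircle z
    obtain ⟨P, hP, rfl⟩ := exists_sq_eq_side_eq
      (c := (4 * b ^ 2 * m ^ 2 * x ^ 2 - 1) / (4 * m)) (div_pos_of_neg_of_neg
        (by nlinarith [sq_nonneg y, sq_nonneg (b * m)]) (by linarith)) i
    refine ⟨⟨(x, y, P), mem_Gamma2 hL (by linear_combination hc) ?_⟩, rfl⟩
    rw [hP, mul_div_cancel₀ _ (by simp [hm'.ne])]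

end

/-! ### The critical curve Γ₂ and the quotients when 4a²m² ≤ 1 -/

theorem toCircle_mul {x y u v : ℝ} (h : x ^ 2 + y ^ 2 = 1) (h' : u ^ 2 + v ^ 2 = 1)
    (h'' : (x * u - y * v) ^ 2 + (x * v + y * u) ^ 2 = 1) :
    toCircle x y h * toCircle u v h' = toCircle (x * u - y * v) (x * v + y * u) h'' := by
  rw [Circle.ext_iff]
  rfl

theorem toCircle_inv {x y : ℝ} (h : x ^ 2 + y ^ 2 = 1) (h' : x ^ 2 + (-y) ^ 2 = 1) :
    (toCircle x y h)⁻¹ = toCircle x (-y) h' := by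
  rw [Circle.ext_iff, Circle.coe_inv_eq_conj]
  rfl

theorem exists_circle_sq_eq (z : Circle) : ∃ c : Circle, c * c = z :=
  ⟨Circle.exp (Complex.arg z / 2), by rw [← Circle.exp_add, add_halves, Circle.exp_arg]⟩

/-- Surjectivity of (c, d) ↦ (cd, cd⁻¹), the quotient map of the torus by (c, d) ↦ (−c, −d); c is a
square root of zw. -/
theorem exists_circle_mul_eq (z w : Circle) : ∃ c d : Circle, c * d = z ∧ c * d⁻¹ = w := by
  obtain ⟨c, hc⟩ := exists_circle_sq_eq (z * w)
  refine ⟨c, c⁻¹ * z, mul_inv_cancel_left c z, ?_⟩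
  rw [mul_inv_rev, inv_inv, mul_left_comm, hc, inv_mul_cancel_left]

section

variable {a b m h : ℝ}

theorem exists_sq_eq_neg (hL : (m, h) ∈ L0 a b) : ∃ t, 0 < t ∧ -m = t ^ 2 :=
  have hm : m < 0 := hL.2
  ⟨_, Real.sqrt_pos.2 (neg_pos.2 hm), (Real.sq_sqrt (neg_pos.2 hm).le).symm⟩

/-- At this value (2tP)² = Q², so (Q, √2 u, 2tP) runs over two great circles of the sphere of radius
√2. Stereographic projection from (0, 0, √2) sends them to the two plane circles. -/
theorem gamma2_homeomorph_doubleCircle (hL : (m, h) ∈ L0 a b)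
    (hm : 4 * b ^ 2 * m ^ 2 = 1) : Nonempty (Gamma2 a b 0 m h ≃ₜ doubleCircle) := by
  have : CompactSpace (Gamma2 a b 0 m h) := isCompact_iff_compactSpace.1 (isCompact_Gamma2 0)
  obtain ⟨t, ht0, ht⟩ := exists_sq_eq_neg hL
  obtain ⟨w, hw0, hw⟩ : ∃ w : ℝ, 0 < w ∧ w ^ 2 = 2 := ⟨√2, by positivity, by norm_num⟩
  have hp : ∀ {u Q P : ℝ}, (u, Q, P) ∈ Gamma2 a b 0 m h → (2 * t * P) ^ 2 = Q ^ 2 := by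
    intro u Q P hx
    have := Gamma2.sq_P hL hx
    rw [hm] at this
    linear_combination -this - 4 * P ^ 2 * ht - hx.1
  have hd : ∀ {u Q P : ℝ}, (u, Q, P) ∈ Gamma2 a b 0 m h → 0 < w - 2 * t * P := by
    intro u Q P hx
    have h₁ := hp hx
    have h₂ : Q ^ 2 + u ^ 2 = 1 := hx.1
    nlinarith [sq_nonneg u]
  have hR : ∀ {u Q P : ℝ}, (u, Q, P) ∈ Gamma2 a b 0 m h →
      ((Q / (w - 2 * t * P)) ^ 2 + (w * u / (w - 2 * t * P)) ^ 2) * (w - 2 * t * P) =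
        w + 2 * t * P := by
    intro u Q P hx
    have h₀ := (hd hx).ne'
    have h₂ : Q ^ 2 + u ^ 2 = 1 := hx.1
    field_simp
    linear_combination 2 * h₂ + u ^ 2 * hw - hw + hp hx
  have hmem : ∀ x : Gamma2 a b 0 m h,
      (x.1.2.1 / (w - 2 * t * x.1.2.2), w * x.1.1 / (w - 2 * t * x.1.2.2)) ∈ doubleCircle := by
    rintro ⟨⟨u, Q, P⟩, hx⟩
    have h₀ := (hd hx).ne'
    have h₂ : Q ^ 2 + u ^ 2 = 1 := hx.1
    rcases sq_eq_sq_iff_eq_or_eq_neg.1 (hp hx) with e | e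
    · left
      rw [e] at h₀
      simp only [e]
      field_simp
      linear_combination 2 * h₂ + (u ^ 2 - 1) * hw
    · right
      rw [e] at h₀
      simp only [e]
      field_simp
      linear_combination 2 * h₂ + (u ^ 2 - 1) * hw
  refine nonempty_homeomorph_of_bijective (f := fun x : Gamma2 a b 0 m h =>
    (⟨_, hmem x⟩ : doubleCircle)) ?_ ⟨?_, ?_⟩
  · refine Continuous.subtype_mk ?_ _
    refine Continuous.prodMk ?_ ?_ <;>
      exact Continuous.div (by fun_prop) (by fun_prop) fun x => (hd x.2).ne'
  · rintro ⟨⟨u, Q, P⟩, hx⟩ ⟨⟨v, R, S⟩, hy⟩ e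
    simp only [Subtype.mk.injEq, Prod.mk.injEq] at e
    obtain ⟨e₁, e₂⟩ := e
    have h₁ := hR hx
    have h₂ := hR hy
    have d₁ := (hd hx).ne'
    have d₂ := (hd hy).ne'
    rw [e₁, e₂] at h₁
    obtain rfl : P = S := by
      have h₃ : (w + 2 * t * P) * (w - 2 * t * S) = (w + 2 * t * S) * (w - 2 * t * P) := by
        rw [← h₁, ← h₂]
        ring
      apply mul_left_cancel₀ (mul_ne_zero (mul_ne_zero four_ne_zero hw0.ne') ht0.ne')
      linear_combination h₃
    obtain rfl : Q = R := by simpa [div_left_inj' d₁] using e₁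
    obtain rfl : u = v := by simpa [div_left_inj' d₁, hw0.ne'] using e₂
    rfl
  · rintro ⟨⟨x, y⟩, hxy⟩
    have hn : 0 < x ^ 2 + y ^ 2 + 1 := by positivity
    have hx2 : (x ^ 2 + y ^ 2 - 1) ^ 2 = 4 * x ^ 2 := by
      rcases hxy with h | h
      · rw [show x ^ 2 + y ^ 2 - 1 = 2 * x by linear_combination h]
        ring
      · rw [show x ^ 2 + y ^ 2 - 1 = -(2 * x) by linear_combination h]
        ring
    have hd' : w - 2 * t * (w * (x ^ 2 + y ^ 2 - 1) / ((x ^ 2 + y ^ 2 + 1) * (2 * t))) =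
        2 * w / (x ^ 2 + y ^ 2 + 1) := by
      field_simp
      ring
    -- Inverse stereographic projection.
    refine ⟨⟨(2 * y / (x ^ 2 + y ^ 2 + 1), 2 * w * x / (x ^ 2 + y ^ 2 + 1),
      w * (x ^ 2 + y ^ 2 - 1) / ((x ^ 2 + y ^ 2 + 1) * (2 * t))), mem_Gamma2 hL ?_ ?_⟩, ?_⟩
    · field_simp
      linear_combination 4 * x ^ 2 * hw - hx2
    · rw [hm]
      obtain rfl : m = -t ^ 2 := by linear_combination -ht
      field_simp
      linear_combination -4 * (x ^ 2 + y ^ 2 - 1) ^ 2 * hw - 4 * hx2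
    · simp only [hd', Subtype.mk.injEq, Prod.mk.injEq]
      constructor <;> field_simp

/-- χ preserves the signs of Q₁ and P₂, which label four tori. On each, with c = (u₁/(2am), P₁/(at))
and d = (u₂, Q₂) on the unit circle, it changes the signs of c and d, so (cd, cd⁻¹) is a complete
invariant. -/
theorem gammaQuotient_homeomorph_of_lt_one (hb : 0 < b) (hab : b < a) (hL : (m, h) ∈ L0 a b)
    (hm : 4 * a ^ 2 * m ^ 2 < 1) :
    Nonempty (GammaQuotient a b m h ≃ₜ (Fin 2 × Fin 2) × Torus) := by
  obtain ⟨t, ht0, ht⟩ := exists_sq_eq_neg hL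
  have hm0 : m ≠ 0 := hL.2.ne
  have ha : 0 < a := hb.trans hab
  have hmb : 4 * b ^ 2 * m ^ 2 < 1 := by
    have : b ^ 2 ≤ a ^ 2 := by nlinarith
    nlinarith [sq_nonneg m]
  have hQ : ∀ x : ↥(Gamma1 a b 0 m h ×ˢ Gamma2 a b 0 m h), x.1.1.2.1 ≠ 0 :=
    fun x => Gamma1.Q_ne_zero hL hm x.2.1
  have hP : ∀ x : ↥(Gamma1 a b 0 m h ×ˢ Gamma2 a b 0 m h), x.1.2.2.2 ≠ 0 :=
    fun x => Gamma2.P_ne_zero hL hmb x.2.2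
  have hC₁ : ∀ {u Q P : ℝ}, (u, Q, P) ∈ Gamma1 a b 0 m h →
      (u / (2 * a * m)) ^ 2 + (P / (a * t)) ^ 2 = 1 := by
    intro u Q P hx
    have := Gamma1.sq_P hL hx
    obtain rfl : m = -t ^ 2 := by linear_combination -ht
    field_simp
    linear_combination -this
  have hC : ∀ {x y u v : ℝ}, x ^ 2 + y ^ 2 = 1 → v ^ 2 + u ^ 2 = 1 →
      (x * u - y * v) ^ 2 + (x * v + y * u) ^ 2 = 1 ∧
      (x * u + y * v) ^ 2 + (y * u - x * v) ^ 2 = 1 := by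
    intro x y u v h₁ h₂
    constructor <;> linear_combination (v ^ 2 + u ^ 2) * h₁ + h₂
  refine nonempty_homeomorph_gammaQuotient (f := fun x =>
    ((side x.1.1.2.1, side x.1.2.2.2),
      toCircle (x.1.1.1 / (2 * a * m) * x.1.2.1 - x.1.1.2.2 / (a * t) * x.1.2.2.1)
        (x.1.1.1 / (2 * a * m) * x.1.2.2.1 + x.1.1.2.2 / (a * t) * x.1.2.1)
        (hC (hC₁ x.2.1) x.2.2.1).1,
      toCircle (x.1.1.1 / (2 * a * m) * x.1.2.1 + x.1.1.2.2 / (a * t) * x.1.2.2.1)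
        (x.1.1.2.2 / (a * t) * x.1.2.1 - x.1.1.1 / (2 * a * m) * x.1.2.2.1)
        (hC (hC₁ x.2.1) x.2.2.1).2)) ?_ ?_ ?_
  · exact ((continuous_ite_pos (by fun_prop) hQ _ _).prodMk
      (continuous_ite_pos (by fun_prop) hP _ _)).prodMk
      ((continuous_toCircle (by fun_prop) (by fun_prop) _).prodMk
        (continuous_toCircle (by fun_prop) (by fun_prop) _))
  · rintro ⟨⟨i, j⟩, z, z'⟩
    obtain ⟨c, d, rfl, rfl⟩ := exists_circle_mul_eq z z'
    obtain ⟨x, y, hc, rfl⟩ := exists_toCircle c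
    obtain ⟨u, v, hd, rfl⟩ := exists_toCircle d
    have hm2 : 4 * m < 0 := by linarith [show m < 0 from hL.2]
    have hu : (2 * a * m * x) ^ 2 < 1 := by
      nlinarith [sq_nonneg y, sq_nonneg (a * m)]
    obtain ⟨Q, hQ, rfl⟩ := exists_sq_eq_side_eq (sub_pos.2 hu) i
    obtain ⟨P, hP, rfl⟩ := exists_sq_eq_side_eq
      (c := (4 * b ^ 2 * m ^ 2 * u ^ 2 - 1) / (4 * m)) (div_pos_of_neg_of_neg
        (by nlinarith [sq_nonneg v, sq_nonneg (b * m)]) hm2) j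
    refine ⟨⟨((2 * a * m * x, Q, a * t * y), (u, v, P)), mem_Gamma1 hL (by rw [hQ]; ring) ?_,
      mem_Gamma2 hL (by linear_combination hd) ?_⟩, ?_⟩
    · linear_combination -4 * m * a ^ 2 * y ^ 2 * ht - 4 * m ^ 2 * a ^ 2 * hc
    · rw [hP, mul_div_cancel₀ _ hm2.ne]
    · rw [toCircle_inv hd (by linear_combination hd), toCircle_mul hc hd (hC hc (by linarith)).1,
        toCircle_mul hc _ (by linear_combination (hC hc (by linarith : v ^ 2 + u ^ 2 = 1)).2)]
      simp only [Prod.mk.injEq, toCircle_inj]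
      refine ⟨trivial, ⟨?_, ?_⟩, ?_, ?_⟩ <;> field_simp <;> ring
  · rintro ⟨⟨⟨u₁, Q₁, P₁⟩, ⟨u₂, Q₂, P₂⟩⟩, hx⟩ ⟨⟨⟨v₁, R₁, S₁⟩, ⟨v₂, R₂, S₂⟩⟩, hy⟩
    simp only [Prod.mk.injEq, toCircle_inj, side_eq_iff, chi, chi1, chi2, Prod.map_apply]
    constructor
    · rintro ⟨⟨s₁, s₂⟩, ⟨e₁, e₂⟩, e₃, e₄⟩
      have h0 : u₁ / (2 * a * m) ≠ 0 ∨ P₁ / (a * t) ≠ 0 := by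
        by_contra! hc
        have := hC₁ hx.1
        rw [hc.1, hc.2] at this
        norm_num at this
      -- Half-sums and half-differences of the coordinates of cd and cd⁻¹ are the entries of the
      -- tensor product c ⊗ d.
      have key := eq_or_eq_neg_of_tensor_eq (u' := v₁ / (2 * a * m)) (P' := S₁ / (a * t)) h0 hx.2.1 hy.2.1
        (by linear_combination (e₁ + e₃) / 2) (by linear_combination (e₂ - e₄) / 2)
        (by linear_combination (e₂ + e₄) / 2) (by linear_combination (e₃ - e₁) / 2)
      have hc₁ : 2 * a * m ≠ 0 := by simp [ha.ne', hm0]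
      have hc₂ : a * t ≠ 0 := by positivity
      rw [← neg_div, ← neg_div, div_left_inj' hc₁, div_left_inj' hc₂, div_left_inj' hc₁,
        div_left_inj' hc₂] at key
      rcases key with ⟨rfl, rfl, rfl, rfl⟩ | ⟨rfl, rfl, rfl, rfl⟩
      · left
        exact ⟨⟨rfl, eq_of_sq_eq_of_pos_iff (by linear_combination hx.1.1 - hy.1.1) (hQ ⟨_, hx⟩) s₁,
          rfl⟩, rfl, rfl, eq_of_sq_eq_of_pos_iff (by linear_combination hx.2.2 - hy.2.2)
          (hP ⟨_, hx⟩) s₂⟩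
      · right
        exact ⟨⟨rfl, eq_of_sq_eq_of_pos_iff (by linear_combination hx.1.1 - hy.1.1) (hQ ⟨_, hx⟩) s₁,
          rfl⟩, rfl, rfl, eq_of_sq_eq_of_pos_iff (by linear_combination hx.2.2 - hy.2.2)
          (hP ⟨_, hx⟩) s₂⟩
    · rintro (⟨⟨rfl, rfl, rfl⟩, rfl, rfl, rfl⟩ | ⟨⟨rfl, rfl, rfl⟩, rfl, rfl, rfl⟩)
      · simp
      · refine ⟨⟨Iff.rfl, Iff.rfl⟩, ⟨?_, ?_⟩, ?_, ?_⟩ <;> ring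

/-- Put c = (u₁, 2tP₁), a point of the unit circle since (2tP₁)² = Q₁², and d = (u₂, Q₂). The
χ₁-invariants x = Q₁, y = u₁·2tP₁ satisfy y² = x²(1 − x²) and realize Γ₁/χ₁ as the eight-curve; cd
is the remaining circle coordinate, and the sign of P₂ labels two copies. -/
theorem gammaQuotient_homeomorph_of_eq_one (hb : 0 < b) (hab : b < a) (hL : (m, h) ∈ L0 a b)
    (hm : 4 * a ^ 2 * m ^ 2 = 1) :
    Nonempty (GammaQuotient a b m h ≃ₜ Fin 2 × eightCurve × Circle) := by
  obtain ⟨t, ht0, ht⟩ := exists_sq_eq_neg hL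
  have hm0 : m ≠ 0 := hL.2.ne
  have hmb : 4 * b ^ 2 * m ^ 2 < 1 := by
    rw [← hm]
    have : b ^ 2 < a ^ 2 := by nlinarith
    have : 0 < m ^ 2 := by positivity
    nlinarith
  have hP : ∀ x : ↥(Gamma1 a b 0 m h ×ˢ Gamma2 a b 0 m h), x.1.2.2.2 ≠ 0 :=
    fun x => Gamma2.P_ne_zero hL hmb x.2.2
  have hp : ∀ {u Q P : ℝ}, (u, Q, P) ∈ Gamma1 a b 0 m h → (2 * t * P) ^ 2 = Q ^ 2 := by
    intro u Q P hx
    have := Gamma1.sq_P hL hx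
    rw [hm] at this
    linear_combination -this - 4 * P ^ 2 * ht - hx.1
  have hC₁ : ∀ {u Q P : ℝ}, (u, Q, P) ∈ Gamma1 a b 0 m h → u ^ 2 + (2 * t * P) ^ 2 = 1 := by
    intro u Q P hx
    linear_combination hp hx + hx.1
  have hV : ∀ x : ↥(Gamma1 a b 0 m h ×ˢ Gamma2 a b 0 m h),
      (x.1.1.2.1, x.1.1.1 * (2 * t * x.1.1.2.2)) ∈ eightCurve := by
    rintro ⟨⟨⟨u₁, Q₁, P₁⟩, ⟨u₂, Q₂, P₂⟩⟩, hx⟩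
    change (u₁ * (2 * t * P₁)) ^ 2 = Q₁ ^ 2 * (1 - Q₁ ^ 2)
    linear_combination u₁ ^ 2 * hp hx.1 + Q₁ ^ 2 * hx.1.1
  have hC : ∀ {x y u v : ℝ}, x ^ 2 + y ^ 2 = 1 → v ^ 2 + u ^ 2 = 1 →
      (x * u - y * v) ^ 2 + (x * v + y * u) ^ 2 = 1 := by
    intro x y u v h₁ h₂
    linear_combination (v ^ 2 + u ^ 2) * h₁ + h₂
  refine nonempty_homeomorph_gammaQuotient (f := fun x =>
    (side x.1.2.2.2, ⟨_, hV x⟩,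
      toCircle (x.1.1.1 * x.1.2.1 - 2 * t * x.1.1.2.2 * x.1.2.2.1)
        (x.1.1.1 * x.1.2.2.1 + 2 * t * x.1.1.2.2 * x.1.2.1) (hC (hC₁ x.2.1) x.2.2.1))) ?_ ?_ ?_
  · exact (continuous_ite_pos (by fun_prop) hP _ _).prodMk
      ((Continuous.subtype_mk (by fun_prop) _).prodMk
        (continuous_toCircle (by fun_prop) (by fun_prop) _))
  · rintro ⟨i, ⟨⟨x, y⟩, hxy⟩, z⟩
    have hxy : y ^ 2 = x ^ 2 * (1 - x ^ 2) := hxy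
    -- A lift of the eight-curve point to Γ₁, with p = 2tP₁: u = √(1 − x²) and p = y/u, except at x²
    -- = 1, where u = y = 0 and p = x works.
    obtain ⟨u, p, hu, hp', hup⟩ : ∃ u p : ℝ, u ^ 2 = 1 - x ^ 2 ∧ p ^ 2 = x ^ 2 ∧ u * p = y := by
      have hx1 : 0 ≤ 1 - x ^ 2 := by
        by_contra! hc
        have : 0 < x ^ 2 := by linarith
        nlinarith [sq_nonneg y]
      rcases hx1.eq_or_lt with hx1 | hx1
      · refine ⟨0, x, by linarith, rfl, ?_⟩
        rw [← hx1, mul_zero] at hxy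
        rw [zero_mul, eq_comm, ← sq_eq_zero_iff, hxy]
      · have hs := Real.sq_sqrt hx1.le
        have hs0 := (Real.sqrt_pos.2 hx1).ne'
        refine ⟨√(1 - x ^ 2), y / √(1 - x ^ 2), hs, ?_, mul_div_cancel₀ _ hs0⟩
        rw [div_pow, hs, hxy, mul_div_assoc, div_self hx1.ne', mul_one]
    have hc : u ^ 2 + p ^ 2 = 1 := by rw [hu, hp']; ring
    obtain ⟨d, rfl⟩ : ∃ d, toCircle u p hc * d = z := ⟨_, mul_inv_cancel_left _ z⟩
    obtain ⟨v, q, hd, rfl⟩ := exists_toCircle d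
    have hm2 : 4 * m < 0 := by linarith [show m < 0 from hL.2]
    obtain ⟨P, hP, rfl⟩ := exists_sq_eq_side_eq
      (c := (4 * b ^ 2 * m ^ 2 * v ^ 2 - 1) / (4 * m)) (div_pos_of_neg_of_neg
        (by nlinarith [sq_nonneg q, sq_nonneg (b * m)]) hm2) i
    have hpt : 2 * t * (p / (2 * t)) = p := mul_div_cancel₀ _ (by positivity)
    refine ⟨⟨((u, x, p / (2 * t)), (v, q, P)), mem_Gamma1 hL (by rw [hu]; ring) ?_,
      mem_Gamma2 hL (by linear_combination hd) ?_⟩, ?_⟩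
    · rw [hm]
      have : 4 * m * (p / (2 * t)) ^ 2 = -(2 * t * (p / (2 * t))) ^ 2 := by
        linear_combination -4 * (p / (2 * t)) ^ 2 * ht
      rw [this, hpt]
      linear_combination -hc
    · rw [hP, mul_div_cancel₀ _ hm2.ne]
    · rw [toCircle_mul hc hd (hC hc (by linarith))]
      simp only [hpt, hup]
  · rintro ⟨⟨⟨u₁, Q₁, P₁⟩, ⟨u₂, Q₂, P₂⟩⟩, hx⟩ ⟨⟨⟨v₁, R₁, S₁⟩, ⟨v₂, R₂, S₂⟩⟩, hy⟩
    simp only [Prod.mk.injEq, Subtype.mk.injEq, toCircle_inj, side_eq_iff, chi, chi1, chi2,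
      Prod.map_apply]
    constructor
    · rintro ⟨s, ⟨rfl, e₁⟩, e₂, e₃⟩
      have k₁ := hC₁ hx.1
      have k₂ := hC₁ hy.1
      have k₃ := hp hx.1
      have k₄ := hp hy.1
      have hu : u₁ ^ 2 = v₁ ^ 2 := by linear_combination hx.1.1 - hy.1.1
      -- The inner product of (u₁, 2tP₁) and (v₁, 2tS₁). These unit vectors share the squares and
      -- the product of their coordinates, so they agree up to the sign c = ±1.
      obtain ⟨c, hc⟩ : ∃ c, c = u₁ * v₁ + 2 * t * P₁ * (2 * t * S₁) := ⟨_, rfl⟩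
      have hc2 : c ^ 2 = 1 := by
        linear_combination (c + u₁ * v₁ + 2 * t * P₁ * (2 * t * S₁)) * hc - u₁ ^ 2 * hu
          - 2 * u₁ * (2 * t * P₁) * e₁ - (2 * t * P₁) ^ 2 * (k₃ - k₄)
          + (u₁ ^ 2 + (2 * t * P₁) ^ 2 + 1) * k₁
      have hsum : (u₁ - c * v₁) ^ 2 + (2 * t * P₁ - c * (2 * t * S₁)) ^ 2 = 0 := by
        linear_combination k₁ + c ^ 2 * k₂ + 2 * c * hc - hc2
      have a₁ : u₁ = c * v₁ := by
        nlinarith [sq_nonneg (u₁ - c * v₁), sq_nonneg (2 * t * P₁ - c * (2 * t * S₁))]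
      have a₂ : P₁ = c * S₁ := by
        apply mul_left_cancel₀ (mul_ne_zero two_ne_zero ht0.ne')
        nlinarith [sq_nonneg (u₁ - c * v₁), sq_nonneg (2 * t * P₁ - c * (2 * t * S₁))]
      have a₃ : c * u₂ = v₂ := by
        rw [a₁, a₂] at e₂ e₃
        linear_combination v₁ * e₂ + 2 * t * S₁ * e₃ + (v₂ - c * u₂) * k₂
      have a₄ : c * Q₂ = R₂ := by
        rw [a₁, a₂] at e₂ e₃
        linear_combination v₁ * e₃ - 2 * t * S₁ * e₂ + (R₂ - c * Q₂) * k₂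
      have a₅ : P₂ = S₂ := by
        refine eq_of_sq_eq_of_pos_iff ?_ (hP ⟨_, hx⟩) s
        have : P₂ ^ 2 = b ^ 2 * m * u₂ ^ 2 - b * 0 * u₂ - hStar a b m h := hx.2.2
        rw [show S₂ ^ 2 = b ^ 2 * m * v₂ ^ 2 - b * 0 * v₂ - hStar a b m h from hy.2.2, this, ← a₃]
        linear_combination -b ^ 2 * m * u₂ ^ 2 * hc2
      rcases sq_eq_sq_iff_eq_or_eq_neg.1 (hc2.trans (one_pow 2).symm) with rfl | rfl
      · left
        refine ⟨⟨?_, rfl, ?_⟩, ?_, ?_, a₅⟩ <;> linarith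
      · right
        refine ⟨⟨?_, rfl, ?_⟩, ?_, ?_, a₅⟩ <;> linarith
    · rintro (⟨⟨rfl, rfl, rfl⟩, rfl, rfl, rfl⟩ | ⟨⟨rfl, rfl, rfl⟩, rfl, rfl, rfl⟩)
      · simp
      · refine ⟨Iff.rfl, ⟨rfl, ?_⟩, ?_, ?_⟩ <;> ring

end

end

end DoubleField

/-! ### The arcs of L₀ and the topological types -/

namespace DoubleField

section

variable {a b : ℝ}

theorem q1_mem_L0 (hb : 0 < b) : q1 a b ∈ L0 a b := by
  constructor
  · simp only [q1]
    field_simp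
    ring
  · simp only [q1]
    exact div_neg_of_neg_of_pos (by norm_num) (by positivity)

theorem q2_mem_L0 (ha : 0 < a) : q2 a b ∈ L0 a b := by
  constructor
  · simp only [q2]
    field_simp
    ring
  · simp only [q2]
    exact div_neg_of_neg_of_pos (by norm_num) (by positivity)

theorem eq_of_mem_L0 {c d : ℝ × ℝ} (hc : c ∈ L0 a b) (hd : d ∈ L0 a b) (h : c.1 = d.1) : c = d := by
  refine Prod.ext h ?_
  obtain ⟨h₁, h₂⟩ := hc
  obtain ⟨h₃, -⟩ := hd
  rw [← h] at h₃
  apply mul_left_cancel₀ (mul_ne_zero two_ne_zero h₂.ne)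
  linear_combination h₁ - h₃

theorem L0_eq_union (hb : 0 < b) (hab : b < a) :
    L0 a b = segment11 a b ∪ {q1 a b} ∪ segment12 a b ∪ {q2 a b} ∪ segment13 a b := by
  ext c
  constructor
  · intro hc
    rcases lt_trichotomy c.1 (q1 a b).1 with h | h | h
    · exact Or.inl (Or.inl (Or.inl (Or.inl ⟨hc, h⟩)))
    · exact Or.inl (Or.inl (Or.inl (Or.inr (eq_of_mem_L0 hc (q1_mem_L0 hb) h))))
    · rcases lt_trichotomy c.1 (q2 a b).1 with h' | h' | h'
      · exact Or.inl (Or.inl (Or.inr ⟨hc, h, h'⟩))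
      · exact Or.inl (Or.inr (eq_of_mem_L0 hc (q2_mem_L0 (hb.trans hab)) h'))
      · exact Or.inr ⟨hc, h'⟩
  · rintro ((((h | h) | h) | h) | h)
    · exact h.1
    · rw [Set.mem_singleton_iff.1 h]
      exact q1_mem_L0 hb
    · exact h.1
    · rw [Set.mem_singleton_iff.1 h]
      exact q2_mem_L0 (hb.trans hab)
    · exact h.1

theorem one_lt_of_lt_neg_inv {c m : ℝ} (hc : 0 < c) (h : m < -1 / (2 * c)) :
    1 < 4 * c ^ 2 * m ^ 2 := by
  rw [lt_div_iff₀ (by positivity)] at h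
  nlinarith

theorem lt_one_of_neg_inv_lt {c m : ℝ} (hc : 0 < c) (hm : m < 0) (h : -1 / (2 * c) < m) :
    4 * c ^ 2 * m ^ 2 < 1 := by
  rw [div_lt_iff₀ (by positivity)] at h
  nlinarith [mul_neg_of_neg_of_pos hm hc]

theorem q1_lt_q2 (hb : 0 < b) (hab : b < a) : (q1 a b).1 < (q2 a b).1 := by
  simp only [q1, q2]
  rw [div_lt_div_iff₀ (by positivity) (by linarith)]
  linarith

/-- Moving the finite factor of a product to the front. -/
def prodFinHomeomorph (n : ℕ) (X Y : Type*) [TopologicalSpace X] [TopologicalSpace Y] :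
    X × Fin n × Y ≃ₜ Fin n × X × Y :=
  ((Homeomorph.prodAssoc _ _ _).symm.trans
    ((Homeomorph.prodComm X (Fin n)).prodCongr (Homeomorph.refl Y))).trans
    (Homeomorph.prodAssoc _ _ _)

/-- The product of two two-point spaces has four points. -/
def finTwoProdHomeomorph : Fin 2 × Fin 2 ≃ₜ Fin 4 where
  toEquiv := finProdFinEquiv
  continuous_toFun := continuous_of_discreteTopology
  continuous_invFun := continuous_of_discreteTopology

theorem integralManifold_homeomorph_two_torus (hb : 0 < b) (hab : b < a) {m h : ℝ}
    (hc : (m, h) ∈ segment11 a b ∪ segment12 a b) :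
    Nonempty (integralManifold a b m h ≃ₜ Fin 2 × Torus) := by
  have ha : 0 < a := hb.trans hab
  have hL : (m, h) ∈ L0 a b := hc.elim (fun h => h.1) fun h => h.1
  have h₁ : 1 < 4 * a ^ 2 * m ^ 2 := by
    refine one_lt_of_lt_neg_inv ha ?_
    rcases hc with hc | hc
    · exact hc.2.trans (q1_lt_q2 hb hab)
    · exact hc.2.2
  have h₂ : Nonempty (Gamma2 a b 0 m h ≃ₜ Fin 2 × Circle) := by
    rcases hc with hc | hc
    · exact gamma2_homeomorph_of_one_lt hb hL (one_lt_of_lt_neg_inv hb hc.2)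
    · exact gamma2_homeomorph_of_lt_one hL (lt_one_of_neg_inv_lt hb hL.2 hc.2.1)
  obtain ⟨e₀⟩ := nonempty_homeomorph_integralManifold hb hab hL
  obtain ⟨e₁⟩ := gammaQuotient_homeomorph_of_one_lt hL h₁
  obtain ⟨e₂⟩ := h₂
  exact ⟨((e₀.trans e₁).trans ((Homeomorph.refl Circle).prodCongr e₂)).trans
    (prodFinHomeomorph 2 Circle Circle)⟩

theorem integralManifold_homeomorph_four_torus (hb : 0 < b) (hab : b < a) {m h : ℝ}
    (hc : (m, h) ∈ segment13 a b) :
    Nonempty (integralManifold a b m h ≃ₜ Fin 4 × Torus) := by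
  obtain ⟨e₀⟩ := nonempty_homeomorph_integralManifold hb hab hc.1
  obtain ⟨e₁⟩ := gammaQuotient_homeomorph_of_lt_one hb hab hc.1
    (lt_one_of_neg_inv_lt (hb.trans hab) hc.1.2 hc.2)
  exact ⟨(e₀.trans e₁).trans (finTwoProdHomeomorph.prodCongr (Homeomorph.refl Torus))⟩

theorem integralManifold_q1_homeomorph (hb : 0 < b) (hab : b < a) :
    Nonempty (integralManifold a b (q1 a b).1 (q1 a b).2 ≃ₜ doubleCircle × Circle) := by
  have hL : ((q1 a b).1, (q1 a b).2) ∈ L0 a b := q1_mem_L0 hb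
  have h₁ : 1 < 4 * a ^ 2 * (q1 a b).1 ^ 2 :=
    one_lt_of_lt_neg_inv (hb.trans hab) (q1_lt_q2 hb hab)
  have h₂ : 4 * b ^ 2 * (q1 a b).1 ^ 2 = 1 := by
    simp only [q1]
    field_simp
    norm_num
  obtain ⟨e₀⟩ := nonempty_homeomorph_integralManifold hb hab hL
  obtain ⟨e₁⟩ := gammaQuotient_homeomorph_of_one_lt hL h₁
  obtain ⟨e₂⟩ := gamma2_homeomorph_doubleCircle hL h₂
  exact ⟨((e₀.trans e₁).trans ((Homeomorph.refl Circle).prodCongr e₂)).trans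
    (Homeomorph.prodComm _ _)⟩

theorem integralManifold_q2_homeomorph (hb : 0 < b) (hab : b < a) :
    Nonempty (integralManifold a b (q2 a b).1 (q2 a b).2 ≃ₜ Fin 2 × eightCurve × Circle) := by
  have ha : 0 < a := hb.trans hab
  have hL : ((q2 a b).1, (q2 a b).2) ∈ L0 a b := q2_mem_L0 ha
  have h₁ : 4 * a ^ 2 * (q2 a b).1 ^ 2 = 1 := by
    simp only [q2]
    field_simp
    norm_num
  obtain ⟨e₀⟩ := nonempty_homeomorph_integralManifold hb hab hL
  obtain ⟨e₁⟩ := gammaQuotient_homeomorph_of_eq_one hb hab hL h₁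
  exact ⟨e₀.trans e₁⟩

end

end DoubleField

theorem proposition2 (a b : ℝ) (hb : 0 < b) (hab : b < a) :
    -- the three segments and the two points exhaust the curve
    DoubleField.L0 a b =
      DoubleField.segment11 a b ∪ {DoubleField.q1 a b} ∪ DoubleField.segment12 a b ∪
        {DoubleField.q2 a b} ∪ DoubleField.segment13 a b ∧
    -- over the curve, the integral manifold is the quotient of the product of the curves
    (∀ m h : ℝ, (m, h) ∈ DoubleField.L0 a b →
      Nonempty (DoubleField.integralManifold a b m h ≃ₜ DoubleField.GammaQuotient a b m h)) ∧
    -- topological types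
    (∀ m h : ℝ, (m, h) ∈ DoubleField.segment11 a b ∪ DoubleField.segment12 a b →
      Nonempty (DoubleField.integralManifold a b m h ≃ₜ Fin 2 × DoubleField.Torus)) ∧
    (∀ m h : ℝ, (m, h) ∈ DoubleField.segment13 a b →
      Nonempty (DoubleField.integralManifold a b m h ≃ₜ Fin 4 × DoubleField.Torus)) ∧
    Nonempty (DoubleField.integralManifold a b (DoubleField.q1 a b).1 (DoubleField.q1 a b).2 ≃ₜ
      DoubleField.doubleCircle × Circle) ∧
    Nonempty (DoubleField.integralManifold a b (DoubleField.q2 a b).1 (DoubleField.q2 a b).2 ≃ₜ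
      Fin 2 × DoubleField.eightCurve × Circle) := by
  exact ⟨DoubleField.L0_eq_union hb hab,
    fun _ _ hL => DoubleField.nonempty_homeomorph_integralManifold hb hab hL,
    fun _ _ hc => DoubleField.integralManifold_homeomorph_two_torus hb hab hc,
    fun _ _ hc => DoubleField.integralManifold_homeomorph_four_torus hb hab hc,
    DoubleField.integralManifold_q1_homeomorph hb hab,
    DoubleField.integralManifold_q2_homeomorph hb hab⟩
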